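/- Let $\mathbb F_q$ be a finite field, let $X$ be a smooth projective, geometrically integral curve over the rational function field $\mathbb F_q(z)$, with function field $\Sigma_X$ and genus $g=\dim_{\mathbb F_q(z)}H^1(X,\mathcal O_X)$. Let $p_1,\dots,p_n$ be $n\ge 0$ distinct $\mathbb F_q(z)$-rational points of $X$, let $D=p_1+\dots+p_n$, and let $G$ be a divisor on $X$ of degree $r$ whose support is disjoint from that of $D$. Put $$L(G)=\Gamma(X,\mathcal O_X(G))=\{0\}\cup\{s\in\Sigma_X\setminus\{0\} : (s)+G\ge 0\},$$ where $(s)$ is the divisor of $s$. Every $s\in L(G)$ is regular at each $p_i$ and has a value $s(p_i)\in\mathcal O_{X,p_i}/\mathfrak m_{p_i}\simeq\mathbb F_q(z)$. The convolutional Goppa code $\mathcal C(D,G)\subseteq\mathbb F_q(z)^n$ is defined as the image of the $\mathbb F_q(z)$-linear evaluation map $$\alpha\colon L(G)\to\mathbb F_q(z)^n,\qquad \alpha(s)=(s(p_1),\dots,s(p_n)).$$ If $2g-2<r<n$, then $\alpha$ is injective and $$\dim_{\mathbb F_q(z)}\mathcal C(D,G)=r+1-g.$$ -/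

import Mathlib

universe u

noncomputable section

namespace ConvolutionalGoppa

open AlgebraicGeometry CategoryTheory

/-- The local rings of an étale algebra over a Dedekind domain, at primes lying over nonzero primes,
are discrete valuation rings. -/
theorem isDVR_of_etale {B A : Type*} [CommRing B] [IsDedekindDomain B]
    [CommRing A] [Algebra B A] [Algebra.Etale B A] (q : Ideal A) [q.IsPrime]
    [IsDomain (Localization.AtPrime q)] (hq : q.under B ≠ ⊥) :
    IsDiscreteValuationRing (Localization.AtPrime q) := by
  let p := q.under B
  let := Localization.AtPrime.algebraOfLiesOver p q
  have hp := IsLocalization.AtPrime.isDiscreteValuationRing_of_dedekind_domain B hq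
    (Localization.AtPrime p)
  have : IsLocalHom (algebraMap (Localization.AtPrime p) (Localization.AtPrime q)) := by
    rw [RingHom.algebraMap_toAlgebra]
    exact Localization.isLocalHom_localRingHom p q (algebraMap B A) Ideal.LiesOver.over
  have : Module.FaithfullyFlat (Localization.AtPrime p) (Localization.AtPrime q) :=
    Module.FaithfullyFlat.of_flat_of_isLocalHom
  have : IsNoetherianRing A := Algebra.FiniteType.isNoetherianRing B A
  have : IsNoetherianRing (Localization.AtPrime q) :=
    IsLocalization.isNoetherianRing q.primeCompl _ inferInstance
  have : Algebra.EssFiniteType B (Localization.AtPrime q) := .comp B A _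
  have : Algebra.EssFiniteType (Localization.AtPrime p) (Localization.AtPrime q) :=
    .of_comp B _ _
  have : Algebra.FormallyUnramified B (Localization.AtPrime q) :=
    have : Algebra.FormallyUnramified A (Localization.AtPrime q) :=
      .of_isLocalization q.primeCompl
    .comp B A _
  have : Algebra.FormallyUnramified (Localization.AtPrime p) (Localization.AtPrime q) :=
    .of_restrictScalars B _ _
  have hm := Algebra.FormallyUnramified.map_maximalIdeal (R := Localization.AtPrime p)
    (S := Localization.AtPrime q)
  have hinj : Function.Injective
      (algebraMap (Localization.AtPrime p) (Localization.AtPrime q)) :=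
    FaithfulSMul.algebraMap_injective _ _
  have hf : ¬ IsField (Localization.AtPrime q) := by
    rw [IsLocalRing.isField_iff_maximalIdeal_eq, ← hm, Ideal.map_eq_bot_iff_of_injective hinj]
    exact IsDiscreteValuationRing.not_a_field _
  refine ((IsDiscreteValuationRing.TFAE _ hf).out 4 0).mp ?_
  rw [← hm]
  have : (IsLocalRing.maximalIdeal (Localization.AtPrime p)).IsPrincipal := inferInstance
  infer_instance

/-- The local ring at a maximal ideal of a smooth algebra of relative dimension one over a field is a
discrete valuation ring. -/
theorem isDVR_of_smooth_dim_one {k A O : Type u} [CommRing k] (hk : IsField k)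
    [CommRing A] [Algebra k A] [Algebra.IsStandardSmoothOfRelativeDimension 1 k A]
    (q : Ideal A) [hq : q.IsMaximal] [CommRing O] [IsDomain O] [Algebra A O]
    [IsLocalization.AtPrime O q] : IsDiscreteValuationRing O := by
  let := hk.toField
  obtain ⟨g, hg⟩ := Algebra.IsStandardSmoothOfRelativeDimension.exists_etale_mvPolynomial 1 k A
  let h : Polynomial k →ₐ[k] A := g.comp (MvPolynomial.uniqueAlgEquiv k (Fin 1)).symm.toAlgHom
  have hh : h.toRingHom.Etale := by
    have hs := RingHom.Etale.respectsIso.2 (g : MvPolynomial (Fin 1) k →+* A)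
      ((MvPolynomial.uniqueAlgEquiv k (Fin 1)).symm : Polynomial k ≃+* MvPolynomial (Fin 1) k) hg
    exact hs
  algebraize [h.toRingHom]
  have : IsScalarTower k (Polynomial k) A := .of_algebraMap_eq' h.comp_algebraMap.symm
  let e := IsLocalization.algEquiv q.primeCompl (Localization.AtPrime q) O
  have : IsDomain (Localization.AtPrime q) := e.toMulEquiv.isDomain
  have hb : q.under (Polynomial k) ≠ ⊥ := by
    intro hbot
    let := Ideal.Quotient.field q
    have : Algebra.FiniteType k A := .trans (S := Polynomial k) inferInstance inferInstance
    have : Module.Finite k (A ⧸ q) := finite_of_finite_type_of_isJacobsonRing k (A ⧸ q)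
    have hi : IsIntegral k (algebraMap (Polynomial k) (A ⧸ q) Polynomial.X) :=
      Algebra.IsIntegral.isIntegral _
    have hinj : Function.Injective (algebraMap (Polynomial k) (A ⧸ q)) := by
      rw [injective_iff_map_eq_zero]
      intro a ha
      rw [IsScalarTower.algebraMap_apply (Polynomial k) A (A ⧸ q), Ideal.Quotient.algebraMap_eq,
        Ideal.Quotient.eq_zero_iff_mem] at ha
      have : a ∈ q.under (Polynomial k) := ha
      rwa [hbot] at this
    rw [isIntegral_algebraMap_iff hinj] at hi
    exact Polynomial.transcendental_X k hi.isAlgebraic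
  have := isDVR_of_etale (B := Polynomial k) q hb
  exact IsDiscreteValuationRing.RingEquivClass.isDiscreteValuationRing e

/-- A smooth projective (geometrically integral) curve over a field `k`: a scheme, proper, smooth of
relative dimension one and geometrically integral over `Spec k`. (A proper curve over a field is
automatically projective.) -/
structure SmoothProjectiveCurve (k : Type u) [Field k] where
  /-- the underlying scheme -/
  X : Scheme.{u}
  /-- the structure morphism -/
  hom : X ⟶ Spec (CommRingCat.of k)
  [proper : IsProper hom]
  [smooth : SmoothOfRelativeDimension 1 hom]
  [geometricallyIntegral : GeometricallyIntegral hom]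

namespace SmoothProjectiveCurve

variable {k : Type u} [Field k] (C : SmoothProjectiveCurve k)

instance : IsProper C.hom := C.proper

instance : SmoothOfRelativeDimension 1 C.hom := C.smooth

instance : GeometricallyIntegral C.hom := C.geometricallyIntegral

instance : IsIntegral C.X :=
  GeometricallyIntegral.isIntegral_of_subsingleton C.hom

/-- The local ring `O_x` of the curve at a point `x`. -/
abbrev LocalRing (x : C.X) : Type u := C.X.presheaf.stalk x

/-- The field of rational functions of the curve: the local ring at the generic point. -/
abbrev FunctionField : Type u := C.X.functionField

/-- The structure map `k → O_x`, the composite `k → Γ(X, O_X) → O_x`. -/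
def toLocalRing (x : C.X) : k →+* C.LocalRing x :=
  ((Scheme.ΓSpecIso (CommRingCat.of k)).inv ≫ C.hom.appTop ≫
    C.X.presheaf.germ ⊤ x (TopologicalSpace.Opens.mem_top x)).hom

instance (x : C.X) : Algebra k (C.LocalRing x) := (C.toLocalRing x).toAlgebra

instance (x : C.X) : IsScalarTower k (C.LocalRing x) C.FunctionField := by
  apply IsScalarTower.of_algebraMap_eq'
  have h := C.X.presheaf.germ_stalkSpecializes (U := ⊤) (TopologicalSpace.Opens.mem_top x)
    ((genericPoint_spec C.X).specializes trivial)
  exact congrArg (fun f => ((Scheme.ΓSpecIso (CommRingCat.of k)).inv ≫ C.hom.appTop ≫ f).hom) h.symm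

/-- The closed points of the curve. -/
def ClosedPoint : Type u := {x : C.X // IsClosed ({x} : Set C.X)}

variable {C} in
/-- The local ring of the curve at a closed point. -/
abbrev ClosedPoint.O (x : C.ClosedPoint) : Type u := C.LocalRing x.1

variable {C} in
/-- The residue field of the curve at a closed point, an extension of `k`. -/
abbrev ClosedPoint.κ (x : C.ClosedPoint) : Type u := IsLocalRing.ResidueField x.O

/-- The local ring of a smooth curve at a closed point is a discrete valuation ring. -/
instance (x : C.ClosedPoint) : IsDiscreteValuationRing x.O := by
  obtain ⟨x, hx⟩ := x
  obtain ⟨U, hU, V, hV, hxV, e, hs⟩ :=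
    SmoothOfRelativeDimension.exists_isStandardSmoothOfRelativeDimension (n := 1) (f := C.hom) x
  have hUt : U = ⊤ := by
    ext y
    simp only [TopologicalSpace.Opens.coe_top, Set.mem_univ, iff_true]
    exact Subsingleton.elim (C.hom x) y ▸ e hxV
  subst hUt
  have hk := isField_of_isIntegral_of_subsingleton (Spec (CommRingCat.of k))
  algebraize [(C.hom.appLE ⊤ V e).hom]
  have hmax := hV.primeIdealOf_isMaximal_of_isClosed ⟨x, hxV⟩ hx
  have hloc := hV.isLocalization_stalk ⟨x, hxV⟩
  let := TopCat.Presheaf.algebra_section_stalk C.X.presheaf (⟨x, hxV⟩ : V)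
  exact isDVR_of_smooth_dim_one (O := C.LocalRing x) hk
    (hV.primeIdealOf ⟨x, hxV⟩).asIdeal

variable {C}

/-- The normalized multiplicative valuation of the function field at a closed point. -/
def ClosedPoint.valuation (x : C.ClosedPoint) :
    Valuation C.FunctionField (WithZero (Multiplicative ℤ)) :=
  (IsDiscreteValuationRing.maximalIdeal x.O).valuation C.FunctionField

/-- The order of vanishing `ord_x(s)` of a nonzero rational function `s` at a closed point `x`; this
is the coefficient of `x` in the divisor `(s)`. (The value at `s = 0` is irrelevant.) -/
def ClosedPoint.ord (x : C.ClosedPoint) (s : C.FunctionField) : ℤ :=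
  -WithZero.log (x.valuation s)

/-- The subring of the rational functions that are regular at `x`: the image of `O_x` in the function
field. -/
def ClosedPoint.regular (x : C.ClosedPoint) : Subalgebra k C.FunctionField :=
  (IsScalarTower.toAlgHom k x.O C.FunctionField).range

theorem ClosedPoint.le_ord_iff (x : C.ClosedPoint) {s : C.FunctionField} (hs : s ≠ 0) (m : ℤ) :
    m ≤ x.ord s ↔ x.valuation s ≤ WithZero.exp (-m) := by
  rw [ClosedPoint.ord, le_neg, WithZero.log_le_iff_le_exp ((Valuation.ne_zero_iff _).mpr hs)]

theorem ClosedPoint.mem_regular_of_valuation_le_one (x : C.ClosedPoint) {s : C.FunctionField}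
    (hs : x.valuation s ≤ 1) : s ∈ x.regular := by
  obtain ⟨a, ha⟩ := IsDiscreteValuationRing.exists_lift_of_le_one hs
  exact ⟨a, ha⟩

theorem ClosedPoint.valuation_le_one (x : C.ClosedPoint) (a : x.O) :
    x.valuation (algebraMap x.O C.FunctionField a) ≤ 1 :=
  IsDedekindDomain.HeightOneSpectrum.valuation_le_one _ a

theorem ClosedPoint.valuation_smul_le (x : C.ClosedPoint) (c : k) (s : C.FunctionField) :
    x.valuation (c • s) ≤ x.valuation s := by
  rw [Algebra.smul_def, IsScalarTower.algebraMap_apply k x.O C.FunctionField, map_mul]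
  exact mul_le_of_le_one_left' (x.valuation_le_one _)

variable (C)

/-- A divisor on the curve: a finite integral combination of closed points. -/
abbrev Divisor : Type u := C.ClosedPoint →₀ ℤ

variable {C} in
/-- The degree of a divisor, each closed point `x` being counted with weight `[κ(x) : k]`. -/
def Divisor.degree (F : C.Divisor) : ℤ :=
  F.sum fun x m => m * (Module.finrank k x.κ : ℤ)

theorem mem_L_iff_aux (F : C.Divisor) (s : C.FunctionField) :
    (s ≠ 0 → ∀ x : C.ClosedPoint, 0 ≤ x.ord s + F x) ↔
      ∀ x : C.ClosedPoint, x.valuation s ≤ WithZero.exp (F x) := by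
  by_cases hs : s = 0
  · simp [hs]
  · simp only [ne_eq, hs, not_false_eq_true, forall_const]
    refine forall_congr' fun x => ?_
    rw [← neg_le_iff_add_nonneg, x.le_ord_iff hs, neg_neg]

/-- The space `L(F) = Γ(X, O_X(F))` of the rational functions `s` with `s = 0` or `(s) + F ≥ 0`. -/
def L (F : C.Divisor) : Submodule k C.FunctionField where
  carrier := {s | s ≠ 0 → ∀ x : C.ClosedPoint, 0 ≤ x.ord s + F x}
  zero_mem' := fun h => absurd rfl h
  add_mem' {s t} hs ht := by
    simp only [Set.mem_ofPred_eq] at hs ht ⊢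
    rw [mem_L_iff_aux] at hs ht ⊢
    exact fun x => (x.valuation.map_add s t).trans (max_le (hs x) (ht x))
  smul_mem' c s hs := by
    simp only [Set.mem_ofPred_eq] at hs ⊢
    rw [mem_L_iff_aux] at hs ⊢
    exact fun x => (x.valuation_smul_le c s).trans (hs x)

/-- The repartitions (adeles) of the curve: families `(r_x)` of rational functions indexed by the
closed points such that `r_x` is regular at `x` for all but finitely many `x`. -/
def repartition : Submodule k (C.ClosedPoint → C.FunctionField) where
  carrier := {r | {x | r x ∉ x.regular}.Finite}
  zero_mem' := by simp [zero_mem]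
  add_mem' {r s} hr hs := by
    refine (Set.Finite.union hr hs).subset fun x hx => ?_
    by_contra h
    simp only [Set.mem_union, Set.mem_ofPred_eq, not_or, not_not] at h
    exact hx (add_mem h.1 h.2)
  smul_mem' c r hr := by
    refine Set.Finite.subset hr fun x hx h => ?_
    exact hx (Subalgebra.smul_mem _ h c)

/-- The families `(r_x)` with `r_x` regular at `x` for every closed point `x`. -/
def integralRepartition : Submodule k (C.ClosedPoint → C.FunctionField) :=
  Submodule.pi Set.univ fun x => Subalgebra.toSubmodule x.regular

/-- The diagonal embedding of the function field: a rational function as a constant family. -/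
def diagonal : C.FunctionField →ₗ[k] (C.ClosedPoint → C.FunctionField) :=
  LinearMap.pi fun _ => LinearMap.id

/-- The cohomology group `H¹(X, O_X)`, computed from the flasque resolution
`0 → O_X → K → ⨁ₓ (K / O_x) → 0` (`K` the constant sheaf of rational functions and the sum of
skyscraper sheaves over the closed points): the cokernel of `K → ⨁ₓ K / O_x`, that is, the
repartitions modulo the everywhere regular ones and the rational functions. -/
abbrev H1 : Type u :=
  C.repartition ⧸ (C.integralRepartition ⊔ LinearMap.range C.diagonal).comap C.repartition.subtype

/-- The genus `g = dim H¹(X, O_X)`. -/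
def genus : ℕ := Module.finrank k C.H1

/-- The rational points: the closed points `x` with `k ≃ κ(x)`. -/
def RationalPoint : Type u :=
  {x : C.ClosedPoint // Function.Bijective (algebraMap k x.κ)}

variable {C}

/-- The isomorphism `k ≃ κ(x)` at a rational point. -/
def RationalPoint.residueEquiv (x : C.RationalPoint) : k ≃ₐ[k] x.1.κ :=
  AlgEquiv.ofBijective (Algebra.ofId k x.1.κ) x.2

/-- The value `s(x) ∈ k` at a rational point `x` of a rational function `s` regular at `x`: the class
of `s ∈ O_x` in `O_x / m_x ≃ k`. -/
def RationalPoint.eval (x : C.RationalPoint) : x.1.regular →ₐ[k] k :=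
  (x.residueEquiv.symm.toAlgHom.comp (IsScalarTower.toAlgHom k x.1.O x.1.κ)).comp
    (AlgEquiv.ofInjective (IsScalarTower.toAlgHom k x.1.O C.FunctionField)
      (IsFractionRing.injective x.1.O C.FunctionField)).symm.toAlgHom

variable (C)

/-- The divisor `D = p₁ + ⋯ + pₙ`. -/
def pointDivisor {n : ℕ} (p : Fin n → C.RationalPoint) : C.Divisor :=
  ∑ i, Finsupp.single (p i).1 1

theorem mem_support_pointDivisor {n : ℕ} (p : Fin n → C.RationalPoint) (i : Fin n) :
    (p i).1 ∈ (C.pointDivisor p).support := by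
  classical
  rw [Finsupp.mem_support_iff, pointDivisor, Finsupp.finsetSum_apply]
  refine ne_of_gt (Finset.sum_pos' (fun j _ => ?_) ⟨i, Finset.mem_univ i, ?_⟩)
  · rw [Finsupp.single_apply]; split_ifs <;> simp
  · simp

theorem L_le_regular {n : ℕ} (p : Fin n → C.RationalPoint) (G : C.Divisor)
    (hG : Disjoint G.support (C.pointDivisor p).support) (i : Fin n) :
    C.L G ≤ Subalgebra.toSubmodule (p i).1.regular := by
  intro s hs
  have h0 : G (p i).1 = 0 := Finsupp.notMem_support_iff.mp fun h =>
    Finset.disjoint_left.mp hG h (C.mem_support_pointDivisor p i)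
  have h1 := (C.mem_L_iff_aux G s).mp hs (p i).1
  rw [h0, WithZero.exp_zero] at h1
  exact (p i).1.mem_regular_of_valuation_le_one h1

/-- The evaluation map `α : L(G) → kⁿ`, `s ↦ (s(p₁), …, s(pₙ))`. -/
def evaluation {n : ℕ} (p : Fin n → C.RationalPoint) (G : C.Divisor)
    (hG : Disjoint G.support (C.pointDivisor p).support) : C.L G →ₗ[k] (Fin n → k) :=
  LinearMap.pi fun i =>
    (p i).eval.toLinearMap ∘ₗ Submodule.inclusion (C.L_le_regular p G hG i)

/-- The code `C(D, G)`, the image of the evaluation map. For `k = F_q(z)` this is the convolutional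
Goppa code associated with the pair `(D, G)`. -/
def goppaCode {n : ℕ} (p : Fin n → C.RationalPoint) (G : C.Divisor)
    (hG : Disjoint G.support (C.pointDivisor p).support) : Submodule k (Fin n → k) :=
  LinearMap.range (C.evaluation p G hG)

end SmoothProjectiveCurve

end ConvolutionalGoppa

end

/-! The kernel of evaluation is contained in `L(G - D)`, which vanishes because `deg (G - D) < 0`.
The image therefore has dimension `dim L(G)`, and the claim becomes Riemann's equality `dim L(G) =
deg G + 1 - g` for `deg G > 2g - 2`. This is proved with adeles over an abstract `PlaceSystem` and
needs neither sheaf cohomology nor a canonical divisor.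

Write `box F` for the families with poles bounded by `F`, and `K` for the constant families. When `F
≤ G`, the space `box G / box F` has length `deg G - deg F`. Splitting it along `K`
(`relLength_eq_inf_add_sup`) yields the growth of `L` plus the drop of `i(F)`, the length of adeles
modulo `box F + K`. With `i(0) = g` this is `riemann_roch`: `l(F) - i(F) = deg F + 1 - g`.

Finiteness of `g` is the main labour. The pole divisor `B` of a separating `x` has degree at most
`[K : k(x)]`, while `l(mB)` grows at least at the rate `m [K : k(x)]`. So `box (mB) + K` has bounded
length over `box 0 + K` and stabilizes; by strong approximation its stable value is the whole adele
space.

Serre duality is replaced by `length_space_le_of_obstruction_ne_zero`: if `i(F) ≠ 0` then `l(F) ≤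
g`, which together with `riemann_roch` forces `deg F ≤ 2g - 2`.

Geometry enters through the axioms of a place system. Charts give finiteness of poles and of residue
fields, separatedness makes distinct places incomparable, and properness with geometric integrality
makes the pole-free functions constant. -/

noncomputable section

namespace ConvolutionalGoppa

/-! ### Relative length of subspaces -/

section RelLength

variable {k V W : Type*} [Field k] [AddCommGroup V] [Module k V] [AddCommGroup W] [Module k W]

/-- The length of `B / (A ∩ B)` for submodules `A`, `B` of a vector space. -/
def relLength (A B : Submodule k V) : ℕ∞ :=
  Module.length k (B ⧸ A.comap B.subtype)

theorem relLength_eq_length_of_surjective {A B : Submodule k V} (g : B →ₗ[k] W)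
    (hg : Function.Surjective g) (hker : LinearMap.ker g = A.comap B.subtype) :
    relLength A B = Module.length k W := by
  rw [relLength, ← hker]
  exact (g.quotKerEquivOfSurjective hg).length_eq

theorem relLength_add {A B C : Submodule k V} (hAB : A ≤ B) (hBC : B ≤ C) :
    relLength A C = relLength A B + relLength B C := by
  have h : A.comap C.subtype ≤ B.comap C.subtype := Submodule.comap_mono hAB
  let f : (B ⧸ A.comap B.subtype) →ₗ[k] (C ⧸ A.comap C.subtype) :=
    Submodule.mapQ _ _ (Submodule.inclusion hBC) (fun x hx => hx)
  refine Module.length_eq_add_of_exact f (Submodule.factor h) ?_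
    (Submodule.factor_surjective h) ?_
  · refine (injective_iff_map_eq_zero f).mpr fun x hx => ?_
    obtain ⟨x, rfl⟩ := Submodule.mkQ_surjective _ x
    exact (Submodule.Quotient.mk_eq_zero _).mpr
      ((Submodule.Quotient.mk_eq_zero (A.comap C.subtype) (x := Submodule.inclusion hBC x)).mp hx)
  · intro y
    obtain ⟨y, rfl⟩ := Submodule.mkQ_surjective _ y
    refine (Submodule.Quotient.mk_eq_zero _).trans ?_
    constructor
    · intro hy
      exact ⟨Submodule.Quotient.mk ⟨y, hy⟩, rfl⟩
    · rintro ⟨z, hz⟩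
      obtain ⟨z, rfl⟩ := Submodule.mkQ_surjective _ z
      have h2 : ((Submodule.inclusion hBC z : C) : V) - y ∈ B :=
        hAB ((Submodule.Quotient.eq (A.comap C.subtype) (x := Submodule.inclusion hBC z)).mp hz)
      have h3 := sub_mem z.2 h2
      simpa using h3

theorem relLength_eq_zero_iff {A B : Submodule k V} : relLength A B = 0 ↔ B ≤ A := by
  rw [relLength, Module.length_eq_zero_iff, Submodule.Quotient.subsingleton_iff]
  exact Submodule.comap_subtype_eq_top

theorem relLength_bot (A : Submodule k V) : relLength ⊥ A = Module.length k A := by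
  refine relLength_eq_length_of_surjective LinearMap.id Function.surjective_id ?_
  ext x
  simp

theorem relLength_sup (A B : Submodule k V) : relLength A (A ⊔ B) = relLength (A ⊓ B) B := by
  let g : B →ₗ[k] (↥(A ⊔ B) ⧸ A.comap (A ⊔ B).subtype) :=
    (A.comap (A ⊔ B).subtype).mkQ ∘ₗ Submodule.inclusion le_sup_right
  refine (relLength_eq_length_of_surjective g ?_ ?_).symm
  · intro y
    obtain ⟨⟨y, hy⟩, rfl⟩ := Submodule.mkQ_surjective _ y
    obtain ⟨a, ha, b, hb, rfl⟩ := Submodule.mem_sup.mp hy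
    refine ⟨⟨b, hb⟩, ?_⟩
    refine (Submodule.Quotient.eq _).mpr ?_
    simpa using ha
  · ext x
    simp [g]

theorem relLength_comap {f : V →ₗ[k] W} (hf : Function.Surjective f) (A B : Submodule k W) :
    relLength (A.comap f) (B.comap f) = relLength A B := by
  let g : B.comap f →ₗ[k] (B ⧸ A.comap B.subtype) :=
    (A.comap B.subtype).mkQ ∘ₗ f.restrict (p := B.comap f) (q := B) (fun x hx => hx)
  refine relLength_eq_length_of_surjective g ?_ ?_
  · refine (Submodule.mkQ_surjective _).comp ?_
    rintro ⟨y, hy⟩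
    obtain ⟨x, rfl⟩ := hf y
    exact ⟨⟨x, hy⟩, rfl⟩
  · ext x
    simp [g]

theorem relLength_map {f : V →ₗ[k] W} (hf : Function.Injective f) (A B : Submodule k V) :
    relLength (A.map f) (B.map f) = relLength A B := by
  let g : B →ₗ[k] (B.map f ⧸ (A.map f).comap (B.map f).subtype) :=
    ((A.map f).comap (B.map f).subtype).mkQ ∘ₗ
      f.restrict (p := B) (q := B.map f) (fun x hx => Submodule.mem_map_of_mem hx)
  refine (relLength_eq_length_of_surjective g ?_ ?_).symm
  · refine (Submodule.mkQ_surjective _).comp ?_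
    rintro ⟨y, x, hx, rfl⟩
    exact ⟨⟨x, hx⟩, rfl⟩
  · ext x
    simp [g, hf.eq_iff]

/-- The length of `B / A` splits along a submodule `D` into the contributions of the intersections
and of the sums with `D`. -/
theorem relLength_eq_inf_add_sup {A B : Submodule k V} (h : A ≤ B) (D : Submodule k V) :
    relLength A B = relLength (A ⊓ D) (B ⊓ D) + relLength (A ⊔ D) (B ⊔ D) := by
  have hC : A ⊔ B ⊓ D ≤ B := sup_le h inf_le_left
  rw [relLength_add (le_sup_left (b := B ⊓ D)) hC, relLength_sup, ← inf_assoc, inf_eq_left.mpr h]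
  congr 1
  -- The modular law, which is where `A ≤ B` is indispensable.
  have h1 : (A ⊔ D) ⊓ B = A ⊔ B ⊓ D := by rw [sup_inf_assoc_of_le _ h, inf_comm]
  have h2 : (A ⊔ D) ⊔ B = B ⊔ D := by
    rw [sup_right_comm, sup_eq_right.mpr h]
  rw [← h1, ← relLength_sup, h2]

end RelLength

end ConvolutionalGoppa

/-! ### Places, weak approximation, and boxes bounded by divisors -/

namespace ConvolutionalGoppa

open WithZero Polynomial

open scoped NNReal in
/-- Weak approximation for a finite family of pairwise incomparable discrete valuations. -/
theorem exists_forall_valuation_sub_lt {K ι : Type*} [Field K] [Finite ι]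
    (v : ι → Valuation K ℤᵐ⁰) (hv : ∀ i j, i ≠ j → ∃ s, v i s ≤ 1 ∧ 1 < v j s)
    (hnt : ∀ i, ∃ s, 1 < v i s) (r : ι → K) (m : ℤ) :
    ∃ f : K, ∀ i, v i (f - r i) ≤ exp m := by
  have h2 : (1 : ℝ≥0) < 2 := by norm_num
  have hmono := WithZeroMulInt.toNNReal_strictMono h2
  -- Sending `exp n` to `2 ^ n` gives real absolute values, for which density of the diagonal in a
  -- finite product is available; the base 2 is arbitrary.
  let w : ι → AbsoluteValue K ℝ := fun i =>
    { toFun x := WithZeroMulInt.toNNReal h2.ne_zero (v i x)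
      map_mul' _ _ := by simp
      nonneg' _ := NNReal.zero_le_coe
      eq_zero' _ := by simp
      add_le' x y := by
        have h := hmono.monotone ((v i).map_add x y)
        rw [hmono.monotone.map_max] at h
        exact_mod_cast h.trans (max_le_add_of_nonneg zero_le zero_le) }
  have hw : ∀ i x y, w i x ≤ w i y ↔ v i x ≤ v i y := fun i x y =>
    NNReal.coe_le_coe.trans hmono.le_iff_le
  have hw' : ∀ i x y, w i x < w i y ↔ v i x < v i y := fun i x y =>
    NNReal.coe_lt_coe.trans hmono.lt_iff_lt
  have hnt' : ∀ i, (w i).IsNontrivial := by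
    intro i
    obtain ⟨s, hs⟩ := hnt i
    refine ⟨s, ?_, ?_⟩
    · rintro rfl
      simp at hs
    · have := (hw' i 1 s).mpr (by simpa using hs)
      rw [map_one] at this
      exact this.ne'
  have hne : Pairwise fun i j => ¬ (w i).IsEquiv (w j) := by
    intro i j hij he
    obtain ⟨s, hs, hs'⟩ := hv i j hij
    have h1 := (hw i s 1).mpr (by simpa using hs)
    have h2 := (he s 1).mp h1
    rw [hw, map_one] at h2
    exact absurd hs' h2.not_gt
  have := Fintype.ofFinite ι
  have hd := AbsoluteValue.denseRange_algebraMap_pi hnt' hne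
  let ε : ℝ := WithZeroMulInt.toNNReal h2.ne_zero (exp m)
  have hε : 0 < ε := NNReal.coe_pos.mpr (WithZeroMulInt.toNNReal_pos _ exp_ne_zero)
  obtain ⟨f, hf⟩ := Metric.denseRange_iff.mp hd (fun i => WithAbs.toAbs (w i) (r i)) ε hε
  refine ⟨f, fun i => ?_⟩
  have h := (dist_pi_lt_iff hε).mp hf i
  rw [dist_comm, dist_eq_norm] at h
  have h3 : w i (f - r i) < ε := h
  exact (hmono.lt_iff_lt.mp (NNReal.coe_lt_coe.mp h3)).le

/-- The ball of radius `exp m` around `0` of a valuation that is trivial on `k`. -/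
def valuationBall {k K : Type*} [Field k] [Field K] [Algebra k K] (v : Valuation K ℤᵐ⁰)
    (hv : ∀ c : k, v (algebraMap k K c) ≤ 1) (m : ℤ) : Submodule k K where
  carrier := {s | v s ≤ exp m}
  zero_mem' := by simp
  add_mem' {s t} hs ht := (v.map_add s t).trans (max_le hs ht)
  smul_mem' c s hs := by
    rw [Set.mem_ofPred_eq, Algebra.smul_def, map_mul]
    exact (mul_le_of_le_one_left' (hv c)).trans hs

/-- The places of a complete curve with function field `K` over `k`: discrete valuations of `K`,
trivial on `k` and pairwise incomparable, with residue fields of finite degree over `k`, such that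
every function has finitely many poles and only the constants have none. -/
structure PlaceSystem (k K ι : Type*) [Field k] [Field K] [Algebra k K] where
  /-- the normalized valuations -/
  val : ι → Valuation K ℤᵐ⁰
  /-- the degrees of the residue fields -/
  residueDegree : ι → ℕ
  val_algebraMap_le_one : ∀ i (c : k), val i (algebraMap k K c) ≤ 1
  exists_val_eq : ∀ i, ∃ t, val i t = exp (-1)
  finite_poles : ∀ s, {i | ¬ val i s ≤ 1}.Finite
  length_residue : ∀ i, relLength (valuationBall (val i) (val_algebraMap_le_one i) (-1))
    (valuationBall (val i) (val_algebraMap_le_one i) 0) = residueDegree i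
  incomparable : ∀ i j, i ≠ j → ∃ s, val i s ≤ 1 ∧ 1 < val j s
  mem_range_of_forall_le_one : ∀ s, (∀ i, val i s ≤ 1) → s ∈ Set.range (algebraMap k K)

namespace PlaceSystem

variable {k K ι : Type*} [Field k] [Field K] [Algebra k K] (S : PlaceSystem k K ι)

/-- The functions `s` with `S.val i s ≤ exp m`. -/
abbrev ball (i : ι) (m : ℤ) : Submodule k K :=
  valuationBall (S.val i) (S.val_algebraMap_le_one i) m

theorem mem_ball {i : ι} {m : ℤ} {s : K} : s ∈ S.ball i m ↔ S.val i s ≤ exp m := Iff.rfl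

theorem exists_val_eq_exp (i : ι) (m : ℤ) : ∃ t, S.val i t = exp m := by
  obtain ⟨t, ht⟩ := S.exists_val_eq i
  refine ⟨t ^ (-m), ?_⟩
  rw [map_zpow₀, ht, ← exp_zsmul]
  simp

/-- Multiplication by an element of value `exp (m + 1)` carries the residue field pair, radii `-1`
and `0`, onto this one. -/
theorem relLength_ball (i : ι) (m : ℤ) :
    relLength (S.ball i m) (S.ball i (m + 1)) = S.residueDegree i := by
  obtain ⟨t, ht⟩ := S.exists_val_eq_exp i (m + 1)
  have ht0 : t ≠ 0 := by
    rintro rfl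
    simp at ht
  have hmap : ∀ l : ℤ, (S.ball i l).map (LinearMap.mulLeft k t) = S.ball i (l + (m + 1)) := by
    intro l
    ext s
    simp only [Submodule.mem_map, LinearMap.mulLeft_apply, mem_ball]
    constructor
    · rintro ⟨a, ha, rfl⟩
      rw [map_mul, ht, exp_add, mul_comm]
      exact mul_le_mul_left ha _
    · intro hs
      refine ⟨t⁻¹ * s, ?_, by field_simp⟩
      rw [map_mul, map_inv₀, ht, ← exp_neg, mul_comm]
      refine (mul_le_mul_left hs _).trans ?_
      rw [← exp_add, add_neg_cancel_right]
  have h := relLength_map (f := LinearMap.mulLeft k t) (mul_right_injective₀ ht0)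
    (S.ball i (-1)) (S.ball i 0)
  rw [hmap, hmap, S.length_residue] at h
  rw [← h]
  congr 2 <;> ring

/-- Families of functions that are regular at almost all places. -/
def adele : Submodule k (ι → K) where
  carrier := {r | {i | ¬ S.val i (r i) ≤ 1}.Finite}
  zero_mem' := by simp
  add_mem' {r s} hr hs := by
    refine (Set.Finite.union hr hs).subset fun i hi => ?_
    by_contra h
    simp only [Set.mem_union, Set.mem_ofPred_eq, not_or, not_not] at h
    exact hi (((S.val i).map_add _ _).trans (max_le h.1 h.2))
  smul_mem' c r hr := by
    refine Set.Finite.subset hr fun i hi h => hi ?_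
    exact (S.ball i 0).smul_mem c (x := r i) h

/-- Families of functions whose poles are bounded by a divisor. -/
def box (F : ι →₀ ℤ) : Submodule k (ι → K) := Submodule.pi Set.univ fun i => S.ball i (F i)

theorem mem_box {F : ι →₀ ℤ} {r : ι → K} :
    r ∈ S.box F ↔ ∀ i, S.val i (r i) ≤ exp (F i) := by
  simp [box, Submodule.mem_pi, mem_ball]

theorem box_mono {F G : ι →₀ ℤ} (h : F ≤ G) : S.box F ≤ S.box G := fun r hr => by
  rw [mem_box] at hr ⊢
  exact fun i => (hr i).trans (exp_le_exp.mpr (h i))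

theorem box_le_adele (F : ι →₀ ℤ) : S.box F ≤ S.adele := fun r hr => by
  rw [mem_box] at hr
  refine F.hasFiniteSupport.subset fun i hi => ?_
  rw [Function.mem_support]
  intro h
  have := hr i
  rw [h] at this
  exact hi this

/-- The constant families. -/
def constants (_ : PlaceSystem k K ι) : Submodule k (ι → K) :=
  LinearMap.range (LinearMap.pi fun _ => LinearMap.id : K →ₗ[k] (ι → K))

theorem constants_le_adele : S.constants ≤ S.adele := by
  rintro _ ⟨s, rfl⟩
  exact S.finite_poles s

/-- The degree of a divisor. -/
def degree (F : ι →₀ ℤ) : ℤ := F.sum fun i m => m * S.residueDegree i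

theorem degree_add (F G : ι →₀ ℤ) : S.degree (F + G) = S.degree F + S.degree G :=
  Finsupp.sum_add_index' (by simp) (by intros; ring)

theorem degree_zero : S.degree 0 = 0 := Finsupp.sum_zero_index

theorem degree_single (i : ι) (m : ℤ) :
    S.degree (Finsupp.single i m) = m * S.residueDegree i :=
  Finsupp.sum_single_index (by simp)

theorem degree_neg (F : ι →₀ ℤ) : S.degree (-F) = -S.degree F := by
  have := S.degree_add F (-F)
  rw [add_neg_cancel, degree_zero] at this
  linarith

theorem degree_sub (F G : ι →₀ ℤ) : S.degree (F - G) = S.degree F - S.degree G := by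
  rw [sub_eq_add_neg, degree_add, degree_neg, sub_eq_add_neg]

theorem degree_nsmul (m : ℕ) (F : ι →₀ ℤ) : S.degree (m • F) = m * S.degree F := by
  induction m with
  | zero => simp [degree_zero]
  | succ m ih => rw [succ_nsmul, degree_add, ih]; push_cast; ring

/-- The two boxes differ only in coordinate `i`, so by the second isomorphism theorem the projection
to that coordinate reduces the count to `relLength_ball`. -/
theorem relLength_box_add_single (F : ι →₀ ℤ) (i : ι) :
    relLength (S.box F) (S.box (F + Finsupp.single i 1)) = S.residueDegree i := by
  classical
  let p : (ι → K) →ₗ[k] K := LinearMap.proj i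
  have hp : Function.Surjective p := fun a => ⟨Pi.single i a, by simp [p]⟩
  have h1 : S.box F = (S.ball i (F i)).comap p ⊓ S.box (F + Finsupp.single i 1) := by
    ext r
    simp only [Submodule.mem_inf, Submodule.mem_comap, mem_box, mem_ball, p, LinearMap.proj_apply]
    constructor
    · refine fun h => ⟨h i, fun j => (h j).trans ?_⟩
      rw [exp_le_exp, Finsupp.add_apply, Finsupp.single_apply]
      split_ifs <;> simp
    · rintro ⟨h, h'⟩ j
      rcases eq_or_ne j i with rfl | hj
      · exact h
      · have := h' j
        rwa [Finsupp.add_apply, Finsupp.single_eq_of_ne hj, add_zero] at this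
  have h2 : (S.ball i (F i)).comap p ⊔ S.box (F + Finsupp.single i 1) =
      (S.ball i (F i + 1)).comap p := by
    apply le_antisymm
    · refine sup_le (Submodule.comap_mono fun s hs => ?_) fun r hr => ?_
      · exact (S.mem_ball.mp hs).trans (exp_le_exp.mpr (by simp))
      · have := S.mem_box.mp hr i
        rw [Finsupp.add_apply, Finsupp.single_eq_same] at this
        exact this
    · intro r hr
      have hr' : S.val i (r i) ≤ exp (F i + 1) := hr
      -- The part supported at `i` lies in the larger box; the remainder has coordinate `0` at `i`.
      rw [← sub_add_cancel r (Pi.single i (r i))]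
      refine Submodule.add_mem_sup ?_ ?_
      · rw [Submodule.mem_comap, mem_ball]
        simp [p]
      · rw [mem_box]
        intro j
        rcases eq_or_ne j i with rfl | hj
        · simpa using hr'
        · rw [Pi.single_eq_of_ne hj]
          simp
  rw [h1, ← relLength_sup, h2, relLength_comap hp, relLength_ball]

theorem exists_relLength_box {F G : ι →₀ ℤ} (h : F ≤ G) :
    ∃ m : ℕ, relLength (S.box F) (S.box G) = m ∧ S.degree G = S.degree F + m := by
  -- Induction on the effective difference, with natural coefficients; `F` stays general because
  -- each step starts from the divisor already reached.
  have key : ∀ (E : ι →₀ ℕ) (F : ι →₀ ℤ), ∃ m : ℕ,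
      relLength (S.box F) (S.box (F + E.mapRange Nat.cast rfl)) = m ∧
        S.degree (F + E.mapRange Nat.cast rfl) = S.degree F + m := by
    intro E
    induction E using Finsupp.induction_linear with
    | zero =>
      intro F
      refine ⟨0, ?_, ?_⟩
      · simp [relLength_eq_zero_iff]
      · simp
    | add E E' ih ih' =>
      intro F
      obtain ⟨m, h1, h2⟩ := ih F
      obtain ⟨m', h1', h2'⟩ := ih' (F + E.mapRange Nat.cast rfl)
      refine ⟨m + m', ?_, ?_⟩
      · rw [Finsupp.mapRange_add Nat.cast_add, ← add_assoc,
          relLength_add (B := S.box (F + E.mapRange Nat.cast rfl)), h1, h1']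
        · simp
        · exact S.box_mono (le_add_of_nonneg_right fun i => by simp)
        · exact S.box_mono (le_add_of_nonneg_right fun i => by simp)
      · rw [Finsupp.mapRange_add Nat.cast_add, ← add_assoc, h2', h2]
        push_cast
        ring
    | single i n =>
      intro F
      refine ⟨n * S.residueDegree i, ?_, ?_⟩
      · induction n with
        | zero => simp [relLength_eq_zero_iff]
        | succ n ih =>
          rw [Finsupp.mapRange_single] at ih ⊢
          push_cast
          rw [Finsupp.single_add, ← add_assoc,
            relLength_add (B := S.box (F + Finsupp.single i (n : ℤ))), ih,
            relLength_box_add_single]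
          · push_cast
            ring
          · exact S.box_mono (le_add_of_nonneg_right (by simp))
          · exact S.box_mono (le_add_of_nonneg_right (by simp))
      · rw [Finsupp.mapRange_single, degree_add, degree_single]
        simp
  have hE : F + ((G - F).mapRange Int.toNat rfl).mapRange Nat.cast rfl = G := by
    ext i
    have := h i
    simp only [Finsupp.add_apply, Finsupp.mapRange_apply, Finsupp.sub_apply]
    omega
  obtain ⟨m, h1, h2⟩ := key ((G - F).mapRange Int.toNat rfl) F
  rw [hE] at h1 h2
  exact ⟨m, h1, h2⟩

end PlaceSystem

end ConvolutionalGoppa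

/-! ### Strong approximation away from the poles of a transcendental function -/

namespace ConvolutionalGoppa

open WithZero Polynomial Filter

theorem eventually_val_pow_mul_le_one {K : Type*} [Field K] (v : Valuation K ℤᵐ⁰) {a : K}
    (ha : v a < 1) (b : K) : ∀ᶠ m : ℕ in atTop, v (a ^ m * b) ≤ 1 := by
  rcases eq_or_ne b 0 with rfl | hb
  · simp
  rcases eq_or_ne a 0 with rfl | ha0
  · filter_upwards [eventually_gt_atTop 0] with m hm
    simp [zero_pow hm.ne']
  have hva : v a ≠ 0 := (Valuation.ne_zero_iff v).mpr ha0
  have hvb : v b ≠ 0 := (Valuation.ne_zero_iff v).mpr hb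
  have h1 : log (v a) < 0 := by rwa [log_lt_iff_lt_exp hva, exp_zero]
  filter_upwards [eventually_ge_atTop (log (v b)).toNat] with m hm
  rw [map_mul, map_pow, ← exp_zero, ← log_le_iff_le_exp (mul_ne_zero (pow_ne_zero _ hva) hvb),
    log_mul (pow_ne_zero _ hva) hvb, log_pow, nsmul_eq_mul]
  have h2 : log (v b) ≤ m := by omega
  nlinarith

theorem finite_of_relLength_ne_top {k V : Type*} [Field k] [AddCommGroup V] [Module k V]
    {A B : Submodule k V} (h : relLength A B ≠ ⊤) : Module.Finite k (B ⧸ A.comap B.subtype) := by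
  rw [relLength, Module.length_ne_top_iff, isFiniteLength_iff_isNoetherian_isArtinian] at h
  have := h.1
  infer_instance

namespace PlaceSystem

variable {k K ι : Type*} [Field k] [Field K] [Algebra k K] (S : PlaceSystem k K ι)

theorem val_aeval_le_one {i : ι} {y : K} (hy : S.val i y ≤ 1) (q : k[X]) :
    S.val i (aeval y q) ≤ 1 := by
  induction q using Polynomial.induction_on' with
  | add p q hp hq =>
    rw [map_add]
    exact ((S.val i).map_add _ _).trans (max_le hp hq)
  | monomial n a =>
    rw [aeval_monomial, map_mul, map_pow]
    exact mul_le_one' (S.val_algebraMap_le_one i a) (pow_le_one' hy n)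

/-- The residue field is finite over `k`, so the powers of `y` satisfy a nontrivial linear relation
in it. -/
theorem exists_val_aeval_lt_one {i : ι} {y : K} (hy : S.val i y ≤ 1) :
    ∃ q : k[X], q ≠ 0 ∧ S.val i (aeval y q) < 1 := by
  have hfin : Module.Finite k (S.ball i 0 ⧸ (S.ball i (-1)).comap (S.ball i 0).subtype) :=
    finite_of_relLength_ne_top (by rw [S.length_residue]; simp)
  let φ : k[X] →ₗ[k] S.ball i 0 :=
    (aeval y).toLinearMap.codRestrict (S.ball i 0) (S.val_aeval_le_one hy)
  let ψ := ((S.ball i (-1)).comap (S.ball i 0).subtype).mkQ ∘ₗ φ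
  have hψ : ¬ Function.Injective ψ := fun h =>
    Polynomial.not_finite (R := k) (Module.Finite.of_injective ψ h)
  rw [injective_iff_map_eq_zero] at hψ
  push Not at hψ
  obtain ⟨q, hq, hq0⟩ := hψ
  refine ⟨q, hq0, ?_⟩
  have h1 : S.val i (aeval y q) ≤ exp (-1) :=
    (Submodule.Quotient.mk_eq_zero ((S.ball i (-1)).comap (S.ball i 0).subtype)
      (x := φ q)).mp hq
  refine h1.trans_lt ?_
  rw [← exp_zero, exp_lt_exp]
  norm_num

/-- As `y` is a unit, removing the powers of `X` from the relation does not change its value, and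
the constant term can then be scaled to 1. This normalization makes `1 - q` divisible by `X` in
`strong_approximation`. -/
theorem exists_val_aeval_lt_one_of_coeff_zero {i : ι} {y : K} (hy : S.val i y = 1) :
    ∃ q : k[X], q.coeff 0 = 1 ∧ S.val i (aeval y q) < 1 := by
  obtain ⟨q, hq0, hq⟩ := S.exists_val_aeval_lt_one hy.le
  obtain ⟨q', hqq', hq'⟩ := exists_eq_pow_rootMultiplicity_mul_and_not_dvd q hq0 0
  rw [C_0, sub_zero] at hqq' hq'
  rw [hqq'] at hq
  rw [X_dvd_iff] at hq'
  refine ⟨C (q'.coeff 0)⁻¹ * q', by simp [hq'], ?_⟩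
  rw [map_mul, map_mul, map_pow, map_pow, aeval_X, hy, one_pow, one_mul] at hq
  rw [map_mul, map_mul, aeval_C]
  exact (mul_le_of_le_one_left' (S.val_algebraMap_le_one i _)).trans_lt hq

theorem exists_val_aeval_mul_le_one {y : K} (T : Finset ι) (hT : ∀ i ∈ T, S.val i y ≤ 1) (f : K) :
    ∃ q : k[X], q ≠ 0 ∧ ∀ i ∈ T, S.val i (aeval y q * f) ≤ 1 := by
  classical
  induction T using Finset.induction_on with
  | empty => exact ⟨1, one_ne_zero, by simp⟩
  | insert i T hi ih =>
    obtain ⟨q, hq0, hq⟩ := ih fun j hj => hT j (Finset.mem_insert_of_mem hj)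
    obtain ⟨p, hp0, hp⟩ := S.exists_val_aeval_lt_one (hT i (Finset.mem_insert_self i T))
    obtain ⟨m, hm⟩ := (eventually_val_pow_mul_le_one (S.val i) hp f).exists
    refine ⟨p ^ m * q, mul_ne_zero (pow_ne_zero _ hp0) hq0, fun j hj => ?_⟩
    rcases Finset.mem_insert.mp hj with rfl | hj'
    · rw [map_mul (aeval y), map_pow, mul_right_comm, map_mul]
      exact mul_le_one' hm (S.val_aeval_le_one (hT j hj) q)
    · rw [map_mul (aeval y), mul_assoc, map_mul]
      exact mul_le_one' (S.val_aeval_le_one (hT j hj) _) (hq j hj')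

theorem exists_val_aeval_mul_le_one_of_coeff_zero {y : K} (T : Finset ι)
    (hT : ∀ i ∈ T, S.val i y = 1) (f : K) :
    ∃ q : k[X], q.coeff 0 = 1 ∧ ∀ i ∈ T, S.val i (aeval y q * f) ≤ 1 := by
  classical
  induction T using Finset.induction_on with
  | empty => exact ⟨1, by simp, by simp⟩
  | insert i T hi ih =>
    obtain ⟨q, hq0, hq⟩ := ih fun j hj => hT j (Finset.mem_insert_of_mem hj)
    obtain ⟨p, hp0, hp⟩ :=
      S.exists_val_aeval_lt_one_of_coeff_zero (hT i (Finset.mem_insert_self i T))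
    obtain ⟨m, hm⟩ := (eventually_val_pow_mul_le_one (S.val i) hp f).exists
    refine ⟨p ^ m * q, ?_, fun j hj => ?_⟩
    · rw [coeff_zero_eq_eval_zero] at *
      simp [hp0, hq0]
    rcases Finset.mem_insert.mp hj with rfl | hj'
    · rw [map_mul (aeval y), map_pow, mul_right_comm, map_mul]
      exact mul_le_one' hm (S.val_aeval_le_one (hT j hj).le q)
    · rw [map_mul (aeval y), mul_assoc, map_mul]
      exact mul_le_one' (S.val_aeval_le_one (hT j hj).le _) (hq j hj')

theorem exists_val_lt_one_of_transcendental {x : K} (hx : Transcendental k x) (T : Finset ι)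
    (hT : ∀ i ∈ T, S.val i x ≤ 1) :
    ∃ y ∈ Set.range (aeval (R := k) x), y ≠ 0 ∧ ∀ i ∈ T, S.val i y < 1 := by
  classical
  induction T using Finset.induction_on with
  | empty => exact ⟨1, ⟨1, by simp⟩, one_ne_zero, by simp⟩
  | insert i T hi ih =>
    obtain ⟨_, ⟨q, rfl⟩, hq0, hq⟩ := ih fun j hj => hT j (Finset.mem_insert_of_mem hj)
    obtain ⟨p, hp0, hp⟩ := S.exists_val_aeval_lt_one (hT i (Finset.mem_insert_self i T))
    have hp0' : aeval x p ≠ 0 := fun h => hp0 (transcendental_iff.mp hx p h)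
    refine ⟨aeval x (p * q), ⟨_, rfl⟩, by rw [map_mul]; exact mul_ne_zero hp0' hq0,
      fun j hj => ?_⟩
    rw [map_mul, map_mul]
    rcases Finset.mem_insert.mp hj with rfl | hj'
    · exact (mul_le_of_le_one_right' (S.val_aeval_le_one (hT j hj) q)).trans_lt hp
    · exact (mul_le_of_le_one_left' (S.val_aeval_le_one (hT j hj) _)).trans_lt (hq j hj')

theorem weak_approximation (T : Finset ι) (r : ι → K) (m : ι → ℤ) :
    ∃ f : K, ∀ i ∈ T, S.val i (f - r i) ≤ exp (m i) := by
  rcases T.eq_empty_or_nonempty with rfl | hne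
  · exact ⟨0, by simp⟩
  obtain ⟨f, hf⟩ := exists_forall_valuation_sub_lt (fun i : T => S.val i)
    (fun i j hij => S.incomparable i j (Subtype.coe_injective.ne hij))
    (fun i => by
      obtain ⟨t, ht⟩ := S.exists_val_eq_exp i 1
      exact ⟨t, by rw [ht, ← exp_zero, exp_lt_exp]; norm_num⟩)
    (fun i => r i) (T.inf' hne m)
  exact ⟨f, fun i hi => (hf ⟨i, hi⟩).trans (exp_le_exp.mpr (Finset.inf'_le m hi))⟩

/-- Strong approximation: an adele differs from a function by a family that is regular outside
the poles of a given transcendental function. -/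
theorem strong_approximation {x : K} (hx : Transcendental k x) {r : ι → K} (hr : r ∈ S.adele) :
    ∃ f : K, ∀ i, S.val i x ≤ 1 → S.val i (r i - f) ≤ 1 := by
  classical
  have hr' : {i | S.val i x ≤ 1 ∧ ¬ S.val i (r i) ≤ 1}.Finite := hr.subset fun i hi => hi.2
  -- A polynomial in `x` vanishing at every pole of `r` where `x` is regular.
  obtain ⟨y, ⟨h, rfl⟩, hy0, hy⟩ := S.exists_val_lt_one_of_transcendental hx hr'.toFinset
    fun i hi => by simpa using (hr'.mem_toFinset.mp hi).1
  set y := aeval x h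
  have hTf : {i | S.val i y < 1}.Finite := (S.finite_poles y⁻¹).subset fun i hi => by
    rw [Set.mem_ofPred_eq, map_inv₀, not_le]
    exact (one_lt_inv₀ (zero_lt_iff.mpr ((Valuation.ne_zero_iff _).mpr hy0))).mpr hi
  obtain ⟨f, hf⟩ := S.weak_approximation hTf.toFinset r 0
  have hT' : {i | (S.val i x ≤ 1 ∧ ¬ S.val i y < 1) ∧ ¬ S.val i f ≤ 1}.Finite :=
    (S.finite_poles f).subset fun i hi => hi.2
  -- The approximation `f` may have new poles where `x` is regular. Away from the zeros of `y` they
  -- are cleared by `q(y)`, with `q(0) = 1`.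
  obtain ⟨q, hq0, hq⟩ := S.exists_val_aeval_mul_le_one_of_coeff_zero (y := y) hT'.toFinset
    (fun i hi => by
      have := (hT'.mem_toFinset.mp hi).1
      exact le_antisymm (S.val_aeval_le_one this.1 h) (not_lt.mp this.2)) f
  have hq1 : X ∣ 1 - q := by
    rw [X_dvd_iff]
    simp [hq0]
  obtain ⟨q', hq'⟩ := hq1
  have hM : ∀ᶠ m : ℕ in atTop, ∀ i ∈ hTf.toFinset, S.val i (aeval y (1 - q) ^ m * f) ≤ 1 := by
    rw [eventually_all_finset]
    intro i hi
    have hi' : S.val i y < 1 := hTf.mem_toFinset.mp hi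
    refine eventually_val_pow_mul_le_one (S.val i) ?_ f
    rw [hq', map_mul, aeval_X, map_mul]
    exact (mul_le_of_le_one_right' (S.val_aeval_le_one hi'.le _)).trans_lt hi'
  obtain ⟨m, hm⟩ := hM.exists
  -- The multiplier `1 - (1 - q)^m` is divisible by `q`, so it clears the new poles. It is also `1`
  -- modulo `y^m`, so for large `m` it keeps the approximation at the zeros of `y`.
  refine ⟨aeval y (1 - (1 - q) ^ m) * f, fun i hi => ?_⟩
  have hyi : S.val i y ≤ 1 := S.val_aeval_le_one hi h
  by_cases hiT : S.val i y < 1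
  · have hiT' := hTf.mem_toFinset.mpr hiT
    have h1 : r i - aeval y (1 - (1 - q) ^ m) * f = aeval y (1 - q) ^ m * f - (f - r i) := by
      rw [map_sub, map_one, map_pow]
      ring
    rw [h1]
    exact ((S.val i).map_sub _ _).trans (max_le (hm i hiT') (hf i hiT'))
  · have hri : S.val i (r i) ≤ 1 := by
      by_contra hcon
      exact hiT (hy i (hr'.mem_toFinset.mpr ⟨hi, hcon⟩))
    refine ((S.val i).map_sub _ _).trans (max_le hri ?_)
    by_cases hfi : S.val i f ≤ 1
    · rw [map_mul (S.val i)]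
      exact mul_le_one' (S.val_aeval_le_one hyi _) hfi
    · obtain ⟨a, ha⟩ : q ∣ 1 - (1 - q) ^ m := by
        simpa using sub_dvd_pow_sub_pow 1 (1 - q) m
      rw [ha, map_mul (aeval y), mul_right_comm, map_mul]
      exact mul_le_one' (hq i (hT'.mem_toFinset.mpr ⟨⟨hi, hiT⟩, hfi⟩)) (S.val_aeval_le_one hyi _)

end PlaceSystem

end ConvolutionalGoppa

/-! ### Pole divisors and their degree -/

namespace ConvolutionalGoppa

open WithZero Polynomial Filter

namespace PlaceSystem

variable {k K ι : Type*} [Field k] [Field K] [Algebra k K] (S : PlaceSystem k K ι)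

/-- The divisor of poles of a function. -/
def poleDivisor (x : K) : ι →₀ ℤ :=
  Finsupp.onFinset (S.finite_poles x).toFinset (fun i => max 0 (log (S.val i x))) fun i hi => by
    rw [Set.Finite.mem_toFinset]
    intro h
    refine hi (max_eq_left ?_)
    rcases eq_or_ne (S.val i x) 0 with h0 | h0
    · rw [h0, log_zero]
    · rwa [log_le_iff_le_exp h0, exp_zero]

theorem poleDivisor_apply (x : K) (i : ι) : S.poleDivisor x i = max 0 (log (S.val i x)) := rfl

theorem poleDivisor_nonneg (x : K) : 0 ≤ S.poleDivisor x := fun _ => le_max_left _ _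

theorem val_le_exp_poleDivisor (x : K) (i : ι) : S.val i x ≤ exp (S.poleDivisor x i) :=
  le_exp_of_log_le (le_max_right _ _)

theorem poleDivisor_eq_zero {x : K} {i : ι} (h : S.val i x ≤ 1) : S.poleDivisor x i = 0 := by
  refine max_eq_left ?_
  rcases eq_or_ne (S.val i x) 0 with h0 | h0
  · rw [h0, log_zero]
  · rwa [log_le_iff_le_exp h0, exp_zero]

theorem log_pos_of_one_lt {a : ℤᵐ⁰} (h : 1 < a) : 0 < log a := by
  rwa [lt_log_iff_exp_lt (zero_lt_one.trans h).ne', exp_zero]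

theorem one_le_poleDivisor {x : K} {i : ι} (h : 1 < S.val i x) : 1 ≤ S.poleDivisor x i :=
  le_max_of_le_right (log_pos_of_one_lt h)

theorem val_eq_exp_poleDivisor {x : K} {i : ι} (h : 1 < S.val i x) :
    S.val i x = exp (S.poleDivisor x i) := by
  rw [poleDivisor_apply, max_eq_right (log_pos_of_one_lt h).le, exp_log (zero_lt_one.trans h).ne']

/-- The estimate `|p(x)| ≤ |x|^(d-1)`, in a form free of subtraction in the exponent. -/
theorem val_aeval_mul_le {x : K} {i : ι} (h : 1 ≤ S.val i x) {d : ℕ} {p : k[X]}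
    (hp : p.degree < d) : S.val i (aeval x p) * S.val i x ≤ S.val i x ^ d := by
  rcases eq_or_ne p 0 with rfl | hp0
  · simp
  have hd : p.natDegree < d := (natDegree_lt_iff_degree_lt hp0).mpr hp
  rw [← map_mul, aeval_eq_sum_range' hd, Finset.sum_mul]
  refine (S.val i).map_sum_le fun e he => ?_
  rw [Algebra.smul_def, mul_assoc, map_mul, ← pow_succ, map_pow]
  exact (mul_le_of_le_one_left' (S.val_algebraMap_le_one i _)).trans
    (pow_le_pow_right₀ h (Finset.mem_range.mp he))

variable [Algebra k[X] K] [IsScalarTower k k[X] K]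

theorem algebraMap_polynomial_eq_aeval (p : k[X]) :
    algebraMap k[X] K p = aeval (algebraMap k[X] K X) p := by
  rw [aeval_algebraMap_apply, aeval_X_left_apply]

theorem transcendental_algebraMap_X [FaithfulSMul k[X] K] :
    Transcendental k (algebraMap k[X] K X) := by
  rw [transcendental_iff]
  intro p hp
  rw [← algebraMap_polynomial_eq_aeval] at hp
  exact (map_eq_zero_iff _ (FaithfulSMul.algebraMap_injective k[X] K)).mp hp

/-- Look at the top coefficients `c` of a relation of degree at most `d`. Since `x^d ∑ c_j w_j`
equals minus the lower terms, `∑ c_j w_j` has value at most `1/|x|` at each pole of `x`. The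
hypothesis then gives `c = 0`, and the degree bound drops. -/
theorem linearIndependent_of_residues {m : ℕ} (w : Fin m → K)
    (hw : ∀ c : Fin m → k, (∀ i, 1 < S.val i (algebraMap k[X] K X) →
      S.val i (∑ j, c j • w j) * S.val i (algebraMap k[X] K X) ≤ 1) → c = 0)
    (hw' : ∀ i, 1 < S.val i (algebraMap k[X] K X) → ∀ j, S.val i (w j) ≤ 1) :
    LinearIndependent k[X] w := by
  set x := algebraMap k[X] K X
  have key : ∀ (d : ℕ) (p : Fin m → k[X]), (∀ j, (p j).degree < d) →
      ∑ j, aeval x (p j) * w j = 0 → p = 0 := by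
    intro d
    induction d with
    | zero =>
      intro p hp _
      ext1 j
      simpa using hp j
    | succ d ih =>
      intro p hp hsum
      let p' : Fin m → k[X] := fun j => p j - C ((p j).coeff d) * X ^ d
      have hp' : ∀ j, (p' j).degree < d := fun j => by
        rw [degree_lt_iff_coeff_zero]
        intro e he
        rcases he.eq_or_lt with rfl | he
        · simp [p']
        · have := (degree_lt_iff_coeff_zero _ _).mp (hp j) e he
          simp [p', this, coeff_X_pow, he.ne']
      have hc : (fun j => (p j).coeff d) = 0 := by
        apply hw
        intro i hi
        have hx0 : S.val i x ^ d ≠ 0 := pow_ne_zero _ (zero_lt_one.trans hi).ne'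
        have h1 : x ^ d * ∑ j, (p j).coeff d • w j = - ∑ j, aeval x (p' j) * w j := by
          rw [eq_neg_iff_add_eq_zero, ← hsum, Finset.mul_sum, ← Finset.sum_add_distrib]
          refine Finset.sum_congr rfl fun j _ => ?_
          simp only [p', map_sub, map_mul, map_pow, aeval_X, aeval_C, Algebra.smul_def]
          ring
        have h2 : S.val i (x ^ d * ∑ j, (p j).coeff d • w j) * S.val i x ≤ S.val i x ^ d := by
          rw [h1, Valuation.map_neg, ← map_mul, Finset.sum_mul]
          refine (S.val i).map_sum_le fun j _ => ?_
          rw [mul_right_comm, map_mul, map_mul]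
          exact (mul_le_of_le_one_right' (hw' i hi j)).trans
            (S.val_aeval_mul_le hi.le (hp' j))
        rw [map_mul, map_pow, mul_assoc] at h2
        exact le_of_mul_le_mul_left (h2.trans_eq (mul_one _).symm) (zero_lt_iff.mpr hx0)
      refine ih p (fun j => ?_) hsum
      have h3 : p' j = p j := by
        have := congrFun hc j
        simp only [Pi.zero_apply] at this
        simp [p', this]
      exact h3 ▸ hp' j
  rw [Fintype.linearIndependent_iff]
  intro g hg j
  have := key (Finset.univ.sup fun j => (g j).natDegree + 1) g (fun j => ?_) ?_
  · rw [this, Pi.zero_apply]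
  · refine degree_le_natDegree.trans_lt ?_
    exact_mod_cast (Nat.lt_succ_self _).trans_le
      (Finset.le_sup (f := fun j => (g j).natDegree + 1) (Finset.mem_univ j))
  · rw [← hg]
    refine Finset.sum_congr rfl fun j _ => ?_
    rw [Algebra.smul_def, algebraMap_polynomial_eq_aeval]

/-- The divisor of poles of `x` has degree at most `[K : k(x)]`. -/
theorem degree_poleDivisor_le {n : ℕ}
    (hmax : ∀ (m : ℕ) (w : Fin m → K), LinearIndependent k[X] w → m ≤ n) :
    S.degree (S.poleDivisor (algebraMap k[X] K X)) ≤ n := by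
  classical
  set x := algebraMap k[X] K X
  set B := S.poleDivisor x
  have hB0 : -B ≤ 0 := neg_nonpos.mpr (S.poleDivisor_nonneg x)
  obtain ⟨m, hm, hdeg⟩ := S.exists_relLength_box hB0
  rw [degree_neg, degree_zero] at hdeg
  have hfin := finite_of_relLength_ne_top (A := S.box (-B)) (B := S.box 0) (by rw [hm]; simp)
  rw [relLength, Module.length_eq_finrank, Nat.cast_inj] at hm
  -- A basis of `box 0 / box (-B)`, whose dimension is `deg B`. Weak approximation to order `B` at
  -- the poles of `x` replaces each basis family by one function `w j`; these turn out independent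
  -- over `k[x]`.
  let b := Module.finBasisOfFinrankEq k _ hm
  choose r hr using fun j => Submodule.Quotient.mk_surjective _ (b j)
  choose w hw using fun j => S.weak_approximation (S.finite_poles x).toFinset (r j : ι → K) (-B)
  have hw1 : ∀ i, 1 < S.val i x → ∀ j, S.val i (w j - (r j : ι → K) i) ≤ exp (-B i) :=
    fun i hi j => hw j i (by simpa using hi)
  have hmn := hmax m w (S.linearIndependent_of_residues w ?_ ?_)
  · have : (m : ℤ) ≤ n := by exact_mod_cast hmn
    linarith
  · intro c hc
    -- Only the poles of `x` impose a condition here; elsewhere `B` is zero and the two boxes agree.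
    have hmem : (∑ j, c j • r j : S.box 0) ∈ (S.box (-B)).comap (S.box 0).subtype := by
      rw [Submodule.mem_comap, mem_box]
      intro i
      by_cases hi : 1 < S.val i x
      · have h1 : S.val i (∑ j, c j • w j) ≤ exp (-B i) := by
          have := hc i hi
          rw [S.val_eq_exp_poleDivisor hi] at this
          rw [exp_neg]
          exact (le_mul_inv_iff₀ exp_pos).mpr this |>.trans_eq (one_mul _)
        have h2 : S.val i (∑ j, c j • (w j - (r j : ι → K) i)) ≤ exp (-B i) :=
          (S.ball i (-B i)).sum_mem fun j _ => (S.ball i (-B i)).smul_mem _ (hw1 i hi j)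
        have h3 : (S.box 0).subtype (∑ j, c j • r j) i =
            ∑ j, c j • w j - ∑ j, c j • (w j - (r j : ι → K) i) := by
          simp [smul_sub]
        rw [h3]
        exact ((S.val i).map_sub _ _).trans (max_le h1 h2)
      · rw [Finsupp.neg_apply, S.poleDivisor_eq_zero (not_lt.mp hi), neg_zero]
        exact S.mem_box.mp (∑ j, c j • r j : S.box 0).2 i
    have h4 := (Submodule.Quotient.mk_eq_zero _).mpr hmem
    have h5 : ∑ j, c j • b j = 0 := by
      rw [← h4, ← Submodule.mkQ_apply, map_sum]
      refine Finset.sum_congr rfl fun j _ => ?_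
      rw [map_smul, Submodule.mkQ_apply, hr]
    funext j
    exact Fintype.linearIndependent_iff.mp b.linearIndependent c h5 j
  · intro i hi j
    have h1 : S.val i ((r j : ι → K) i) ≤ 1 := S.mem_box.mp (r j).2 i
    have h2 : S.val i (w j - (r j : ι → K) i) ≤ 1 := (hw1 i hi j).trans (by
      rw [← exp_zero, exp_le_exp]
      exact hB0 i)
    rw [← sub_add_cancel (w j) ((r j : ι → K) i)]
    exact ((S.val i).map_add _ _).trans (max_le h2 h1)

end PlaceSystem

end ConvolutionalGoppa

/-! ### Finiteness of the genus -/

namespace ConvolutionalGoppa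

open WithZero Polynomial Filter

theorem exists_forall_le_of_forall_le {f : ℕ → ℕ∞} {N : ℕ} (hN : ∀ m, f m ≤ N) :
    ∃ m₀, ∀ m, f m ≤ f m₀ := by
  have hne : ∀ m, f m ≠ ⊤ := fun m => ne_top_of_le_ne_top (ENat.natCast_ne_top N) (hN m)
  have hbdd : BddAbove (Set.range fun m => (f m).toNat) :=
    ⟨N, by rintro _ ⟨m, rfl⟩; exact ENat.toNat_le_of_le_natCast (hN m)⟩
  obtain ⟨m₀, hm₀⟩ := Nat.sSup_mem (Set.range_nonempty fun m => (f m).toNat) hbdd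
  refine ⟨m₀, fun m => ?_⟩
  rw [← ENat.natCast_toNat (hne m), ← ENat.natCast_toNat (hne m₀)]
  exact Nat.cast_le.mpr ((le_csSup hbdd ⟨m, rfl⟩).trans hm₀.ge)

namespace PlaceSystem

variable {k K ι : Type*} [Field k] [Field K] [Algebra k K] (S : PlaceSystem k K ι)

/-- The constant family as a linear map. -/
def constMap (_ : PlaceSystem k K ι) : K →ₗ[k] (ι → K) := LinearMap.pi fun _ => LinearMap.id

theorem constMap_apply (s : K) (i : ι) : S.constMap s i = s := rfl

theorem relLength_bot_box_zero_inf_constants_le :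
    relLength ⊥ (S.box 0 ⊓ S.constants) ≤ 1 := by
  let g : k →ₗ[k] ↥(S.box 0 ⊓ S.constants) :=
    (S.constMap ∘ₗ Algebra.linearMap k K).codRestrict _ fun c =>
      ⟨S.mem_box.mpr fun i => S.val_algebraMap_le_one i c, _, rfl⟩
  have hg : Function.Surjective g := by
    rintro ⟨_, h, s, rfl⟩
    obtain ⟨c, hc⟩ := S.mem_range_of_forall_le_one s (S.mem_box.mp h)
    refine ⟨c, Subtype.ext (funext fun i => ?_)⟩
    exact hc
  rw [relLength_bot]
  refine (Module.length_le_of_surjective g hg).trans ?_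
  rw [Module.length_eq_finrank, Module.finrank_self, Nat.cast_one]

variable [Algebra k[X] K] [IsScalarTower k k[X] K]

/-- Every adele is, up to a function, a family with poles bounded by a multiple of the divisor of
poles of a transcendental function. -/
theorem exists_mem_box_sup_constants [FaithfulSMul k[X] K] {r : ι → K} (hr : r ∈ S.adele) :
    ∃ m : ℕ, r ∈ S.box (m • S.poleDivisor (algebraMap k[X] K X)) ⊔ S.constants := by
  set x := algebraMap k[X] K X
  obtain ⟨f, hf⟩ := S.strong_approximation transcendental_algebraMap_X hr
  have hev : ∀ᶠ m : ℕ in atTop, ∀ i ∈ (S.finite_poles x).toFinset,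
      log (S.val i (r i - f)) ≤ m :=
    (eventually_all_finset _).mpr fun i _ => by
      filter_upwards [eventually_ge_atTop (log (S.val i (r i - f))).toNat] with m hm
      omega
  obtain ⟨m, hm⟩ := hev.exists
  refine ⟨m, ?_⟩
  have h1 : r = (r - S.constMap f) + S.constMap f := (sub_add_cancel _ _).symm
  rw [h1]
  refine Submodule.add_mem_sup (S.mem_box.mpr fun i => ?_) ⟨f, rfl⟩
  rw [Pi.sub_apply, constMap_apply, Finsupp.smul_apply]
  by_cases hi : S.val i x ≤ 1
  · rw [S.poleDivisor_eq_zero hi, smul_zero]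
    exact hf i hi
  · refine le_exp_of_log_le ((hm i (by simpa using hi)).trans ?_)
    rw [nsmul_eq_mul]
    have := S.one_le_poleDivisor (not_le.mp hi)
    nlinarith

/-- A family of functions linearly independent over `k[x]` may be scaled so that its poles are among
those of `x`. -/
theorem exists_linearIndependent_val_le [FaithfulSMul k[X] K] {n : ℕ} {u : Fin n → K}
    (hu : LinearIndependent k[X] u) : ∃ w : Fin n → K, LinearIndependent k[X] w ∧
      ∃ c : ℕ, ∀ i j, S.val i (w j) ≤ exp ((c • S.poleDivisor (algebraMap k[X] K X)) i) := by
  classical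
  set x := algebraMap k[X] K X
  -- Polynomials in `x` clear the finitely many poles of `u j` at which `x` is regular.
  have hq : ∀ j, ∃ q : k[X], q ≠ 0 ∧ ∀ i, S.val i x ≤ 1 → S.val i (aeval x q * u j) ≤ 1 := by
    intro j
    have hfin : {i | S.val i x ≤ 1 ∧ ¬ S.val i (u j) ≤ 1}.Finite :=
      (S.finite_poles (u j)).subset fun i hi => hi.2
    obtain ⟨q, hq0, hq⟩ := S.exists_val_aeval_mul_le_one hfin.toFinset
      (fun i hi => (hfin.mem_toFinset.mp hi).1) (u j)
    refine ⟨q, hq0, fun i hi => ?_⟩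
    by_cases h : S.val i (u j) ≤ 1
    · rw [map_mul]
      exact mul_le_one' (S.val_aeval_le_one hi q) h
    · exact hq i (hfin.mem_toFinset.mpr ⟨hi, h⟩)
  choose q hq0 hq using hq
  have hev : ∀ᶠ c : ℕ in atTop, ∀ i ∈ (S.finite_poles x).toFinset, ∀ j ∈ Finset.univ,
      log (S.val i (aeval x (q j) * u j)) ≤ c :=
    (eventually_all_finset _).mpr fun i _ => (eventually_all_finset _).mpr fun j _ => by
      filter_upwards [eventually_ge_atTop (log (S.val i (aeval x (q j) * u j))).toNat] with m hm
      omega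
  obtain ⟨c, hc⟩ := hev.exists
  refine ⟨fun j => aeval x (q j) * u j, ?_, c, fun i j => ?_⟩
  · rw [Fintype.linearIndependent_iff] at hu ⊢
    intro g hg j
    have h1 := hu (fun j => g j * q j) (by
      rw [← hg]
      refine Finset.sum_congr rfl fun j _ => ?_
      rw [mul_smul, Algebra.smul_def (q j), algebraMap_polynomial_eq_aeval (q j)]) j
    exact (mul_eq_zero.mp h1).resolve_right (hq0 j)
  · rw [Finsupp.smul_apply]
    by_cases hi : S.val i x ≤ 1
    · rw [S.poleDivisor_eq_zero hi, smul_zero]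
      exact hq j i hi
    · refine le_exp_of_log_le ((hc i (by simpa using hi) j (Finset.mem_univ j)).trans ?_)
      rw [nsmul_eq_mul]
      have := S.one_le_poleDivisor (not_le.mp hi)
      nlinarith

include S in
theorem nonempty [FaithfulSMul k[X] K] : Nonempty ι := by
  by_contra h
  rw [not_nonempty_iff] at h
  obtain ⟨c, hc⟩ := S.mem_range_of_forall_le_one (algebraMap k[X] K X) (by simp)
  exact transcendental_algebraMap_X (hc ▸ isAlgebraic_algebraMap c)

/-- The products `x^e w_j` with `e ≤ m` are independent over `k`, number `n (m + 1)`, and have poles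
bounded by `(c + m) B`. -/
theorem le_relLength_bot_box_inf_constants [FaithfulSMul k[X] K] {n : ℕ} {w : Fin n → K}
    (hw : LinearIndependent k[X] w) {c : ℕ}
    (hc : ∀ i j, S.val i (w j) ≤ exp ((c • S.poleDivisor (algebraMap k[X] K X)) i)) (m : ℕ) :
    ((n * (m + 1) : ℕ) : ℕ∞) ≤
      relLength ⊥ (S.box ((c + m) • S.poleDivisor (algebraMap k[X] K X)) ⊓ S.constants) := by
  set x := algebraMap k[X] K X
  set B := S.poleDivisor x
  let P : (Fin n → degreeLT k (m + 1)) →ₗ[k] (Fin n → k[X]) :=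
    LinearMap.pi fun j => (degreeLT k (m + 1)).subtype ∘ₗ LinearMap.proj j
  let g : (Fin n → degreeLT k (m + 1)) →ₗ[k] K :=
    (Fintype.linearCombination k[X] w).restrictScalars k ∘ₗ P
  have hg : ∀ p, g p = ∑ j, aeval x (p j : k[X]) * w j := fun p => by
    change Fintype.linearCombination k[X] w (P p) = _
    rw [Fintype.linearCombination_apply]
    refine Finset.sum_congr rfl fun j _ => ?_
    refine (Algebra.smul_def (p j : k[X]) (w j)).trans ?_
    rw [algebraMap_polynomial_eq_aeval]
  have hbox : ∀ p, S.constMap (g p) ∈ S.box ((c + m) • B) ⊓ S.constants := by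
    intro p
    refine ⟨S.mem_box.mpr fun i => ?_, _, rfl⟩
    rw [constMap_apply, hg]
    refine (S.val i).map_sum_le fun j _ => ?_
    rw [map_mul, add_smul, Finsupp.add_apply, exp_add, mul_comm]
    refine mul_le_mul' (hc i j) ?_
    have hd : (p j : k[X]).natDegree < m + 1 := by
      rcases eq_or_ne (p j : k[X]) 0 with h0 | h0
      · simp [h0]
      · exact (natDegree_lt_iff_degree_lt h0).mpr (mem_degreeLT.mp (p j).2)
    rw [aeval_eq_sum_range' hd]
    refine (S.val i).map_sum_le fun e he => ?_
    rw [Algebra.smul_def, map_mul, map_pow]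
    refine (mul_le_of_le_one_left' (S.val_algebraMap_le_one i _)).trans ?_
    refine (pow_le_pow_left' (S.val_le_exp_poleDivisor x i) e).trans ?_
    rw [← exp_nsmul, exp_le_exp, Finsupp.smul_apply]
    exact nsmul_le_nsmul_left (S.poleDivisor_nonneg x i) (by simpa [Nat.lt_succ_iff] using he)
  have hinj : Function.Injective g := by
    have h1 : Function.Injective P := fun p p' h => funext fun j => Subtype.ext (congrFun h j)
    exact (LinearIndependent.fintypeLinearCombination_injective hw).comp h1
  let G := (S.constMap ∘ₗ g).codRestrict _ hbox
  obtain ⟨i₀⟩ := S.nonempty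
  have hG : Function.Injective G := fun p p' h =>
    hinj (congrFun (congrArg Subtype.val h) i₀)
  rw [relLength_bot]
  refine le_trans ?_ (Module.length_le_of_injective G hG)
  rw [Module.length_pi_of_fintype, (degreeLTEquiv k (m + 1)).length_eq]
  simp [Module.length_eq_finrank, mul_add]

/-- Finiteness of the genus. -/
theorem relLength_box_sup_constants_adele_ne_top [FaithfulSMul k[X] K] {n : ℕ} {u : Fin n → K}
    (hu : LinearIndependent k[X] u)
    (hmax : ∀ (m : ℕ) (w : Fin m → K), LinearIndependent k[X] w → m ≤ n) :
    relLength (S.box 0 ⊔ S.constants) S.adele ≠ ⊤ := by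
  set x := algebraMap k[X] K X
  set B := S.poleDivisor x
  have hB : 0 ≤ B := S.poleDivisor_nonneg x
  have hmono : Monotone fun m : ℕ => S.box (m • B) ⊔ S.constants := fun m m' h =>
    sup_le_sup_right (S.box_mono (nsmul_le_nsmul_left hB h)) _
  have h0 : ∀ m : ℕ, S.box 0 ⊔ S.constants ≤ S.box (m • B) ⊔ S.constants := fun m => by
    simpa using hmono (Nat.zero_le m)
  obtain ⟨w, hw, c, hc⟩ := S.exists_linearIndependent_val_le hu
  -- The length is `deg ((c+m)B) - l((c+m)B) + l(0)`, hence at most `(c+m)n - n(m+1) + 1`; the terms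
  -- in `m` cancel.
  have hbound' : ∀ m : ℕ, relLength (S.box 0 ⊔ S.constants)
      (S.box ((c + m) • B) ⊔ S.constants) ≤ (c * n + 1 : ℕ) := by
    intro m
    have hle : (0 : ι →₀ ℤ) ≤ (c + m) • B := nsmul_nonneg hB _
    obtain ⟨d, hd, hdeg⟩ := S.exists_relLength_box hle
    have hd' : d ≤ (c + m) * n := by
      have h1 := S.degree_poleDivisor_le hmax
      rw [degree_nsmul, degree_zero, zero_add] at hdeg
      have h2 : (d : ℤ) ≤ ((c + m : ℕ) : ℤ) * n := by
        rw [← hdeg]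
        exact mul_le_mul_of_nonneg_left h1 (Nat.cast_nonneg _)
      exact_mod_cast h2
    rw [relLength_eq_inf_add_sup (S.box_mono hle) S.constants] at hd
    have h3 := S.le_relLength_bot_box_inf_constants hw hc m
    rw [relLength_add bot_le (inf_le_inf_right _ (S.box_mono hle))] at h3
    have h4 := S.relLength_bot_box_zero_inf_constants_le
    obtain ⟨e, he, he1⟩ := ENat.le_natCast_iff.mp h4
    obtain ⟨a, ha, -⟩ := ENat.le_natCast_iff.mp (le_self_add.trans_eq hd)
    obtain ⟨b, hb, -⟩ := ENat.le_natCast_iff.mp (le_add_self.trans_eq hd)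
    rw [ha, hb, ← Nat.cast_add, Nat.cast_inj] at hd
    rw [ha, he, ← Nat.cast_add, Nat.cast_le] at h3
    rw [hb, Nat.cast_le]
    nlinarith
  have hbound : ∀ m : ℕ, relLength (S.box 0 ⊔ S.constants)
      (S.box (m • B) ⊔ S.constants) ≤ (c * n + 1 : ℕ) := by
    intro m
    have h1 := hmono (Nat.le_add_left m c)
    have h2 := hbound' m
    rw [relLength_add (h0 m) h1] at h2
    exact le_self_add.trans h2
  obtain ⟨m₀, hm₀⟩ := exists_forall_le_of_forall_le hbound
  have htop := ne_top_of_le_ne_top (ENat.natCast_ne_top _) (hbound m₀)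
  -- An increasing chain of bounded length is constant once the maximal length is attained.
  have hstable : ∀ m : ℕ, S.box (m • B) ⊔ S.constants ≤ S.box (m₀ • B) ⊔ S.constants := by
    intro m
    have h1 := hm₀ (max m m₀)
    rw [relLength_add (h0 m₀) (hmono (le_max_right m m₀))] at h1
    have h2 : relLength (S.box (m₀ • B) ⊔ S.constants)
        (S.box (max m m₀ • B) ⊔ S.constants) = 0 := by
      rw [← nonpos_iff_eq_zero]
      exact (ENat.add_le_add_iff_left htop).mp (by simpa using h1)
    exact (hmono (le_max_left m m₀)).trans (relLength_eq_zero_iff.mp h2)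
  have hadele : S.adele = S.box (m₀ • B) ⊔ S.constants := by
    refine le_antisymm (fun r hr => ?_) (sup_le (S.box_le_adele _) S.constants_le_adele)
    obtain ⟨m, hm⟩ := S.exists_mem_box_sup_constants hr
    exact hstable m hm
  rw [hadele]
  exact htop

end PlaceSystem

end ConvolutionalGoppa

/-! ### Riemann–Roch without a canonical divisor -/

namespace ConvolutionalGoppa

open WithZero

namespace PlaceSystem

variable {k K ι : Type*} [Field k] [Field K] [Algebra k K] (S : PlaceSystem k K ι)

/-- The space of functions whose poles are bounded by a divisor. -/
def space (F : ι →₀ ℤ) : Submodule k K := (S.box F).comap S.constMap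

theorem mem_space {F : ι →₀ ℤ} {s : K} : s ∈ S.space F ↔ ∀ i, S.val i s ≤ exp (F i) :=
  S.mem_box

/-- The length of the obstruction space `adeles / (box F + constants)`. -/
def obstruction (F : ι →₀ ℤ) : ℕ∞ := relLength (S.box F ⊔ S.constants) S.adele

theorem length_space_zero : Module.length k (S.space 0) = 1 := by
  let g : k →ₗ[k] S.space 0 :=
    (Algebra.linearMap k K).codRestrict _ fun c =>
      S.mem_space.mpr fun i => S.val_algebraMap_le_one i c
  have hg : Function.Bijective g := by
    refine ⟨fun c d h => (algebraMap k K).injective (congrArg Subtype.val h), ?_⟩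
    rintro ⟨s, h⟩
    obtain ⟨c, hc⟩ := S.mem_range_of_forall_le_one s (S.mem_space.mp h)
    exact ⟨c, Subtype.ext hc⟩
  rw [← (LinearEquiv.ofBijective g hg).length_eq, Module.length_eq_finrank, Module.finrank_self,
    Nat.cast_one]

variable {g : ℕ}

/-- Choose a functional `ω` that kills `box F + K` but not some adele `r₀`. For `s` in `L(F)` the
functional `r ↦ ω(s r)` kills `box 0 + K`, so it lies in a space of dimension `g`. The assignment is
injective: if `s ≠ 0` gave zero, evaluating at `s⁻¹ r₀` would give `ω r₀ = 0`. -/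
theorem length_space_le_of_obstruction_ne_zero (hg : S.obstruction 0 = g) {F : ι →₀ ℤ}
    (hF : S.obstruction F ≠ 0) : Module.length k (S.space F) ≤ g := by
  rw [obstruction, Ne, relLength_eq_zero_iff, SetLike.not_le_iff_exists] at hF
  obtain ⟨r₀, hr₀, hr₀'⟩ := hF
  obtain ⟨ω, hω, hωF⟩ := Submodule.exists_le_ker_of_notMem hr₀'
  have hωF' : ∀ r ∈ S.box F ⊔ S.constants, ω r = 0 := fun r hr => hωF hr
  let N := (S.box 0 ⊔ S.constants).comap S.adele.subtype
  have hfin : Module.Finite k (S.adele ⧸ N) :=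
    finite_of_relLength_ne_top (by rw [obstruction] at hg; rw [hg]; exact ENat.natCast_ne_top g)
  have hN : Module.length k N.dualAnnihilator = g := by
    rw [← N.dualQuotEquivDualAnnihilator.length_eq, Module.length_eq_finrank,
      Subspace.dual_finrank_eq, ← Module.length_eq_finrank]
    exact hg
  let Φ : K →ₗ[k] Module.Dual k S.adele :=
    ((LinearMap.mul k (ι → K)).compr₂ ω).compl₂ S.adele.subtype ∘ₗ S.constMap
  have hΦ : ∀ (s : K) (r : S.adele), Φ s r = ω (S.constMap s * r) := fun s r => rfl
  have hmem : ∀ s ∈ S.space F, Φ s ∈ N.dualAnnihilator := by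
    intro s hs
    rw [Submodule.mem_dualAnnihilator]
    rintro ⟨r, hr⟩ hrN
    obtain ⟨a, ha, _, ⟨t, rfl⟩, hat⟩ := Submodule.mem_sup.mp hrN
    have hr' : r = a + S.constMap t := hat.symm
    rw [hΦ]
    refine hωF' _ ?_
    change S.constMap s * r ∈ _
    rw [hr', mul_add]
    refine Submodule.add_mem_sup (S.mem_box.mpr fun i => ?_) ⟨s * t, rfl⟩
    rw [Pi.mul_apply, map_mul]
    exact (mul_le_of_le_one_right' (S.mem_box.mp ha i)).trans (S.mem_space.mp hs i)
  let Ψ : S.space F →ₗ[k] N.dualAnnihilator := Φ.restrict hmem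
  have hΨ : Function.Injective Ψ := by
    refine (injective_iff_map_eq_zero Ψ).mpr fun s hs => ?_
    by_contra hs0
    have hs0' : (s : K) ≠ 0 := fun h => hs0 (Subtype.ext h)
    have hs1 : Φ s = 0 := congrArg Subtype.val hs
    have hmem : S.constMap (s : K)⁻¹ * r₀ ∈ S.adele := by
      refine (Set.Finite.union (S.finite_poles (s : K)⁻¹) hr₀).subset fun i hi => ?_
      by_contra h
      simp only [Set.mem_union, Set.mem_ofPred_eq, not_or, not_not] at h
      refine hi ?_
      rw [Pi.mul_apply, map_mul]
      exact mul_le_one' h.1 h.2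
    apply hω
    have h1 := LinearMap.congr_fun hs1 ⟨_, hmem⟩
    rw [hΦ, LinearMap.zero_apply] at h1
    rw [← h1]
    congr 1
    ext i
    simp [constMap_apply, hs0']
  exact (Module.length_le_of_injective Ψ hΨ).trans_eq hN

variable [Nonempty ι]

theorem constMap_injective : Function.Injective S.constMap := fun s t h => by
  obtain ⟨i⟩ := ‹Nonempty ι›
  exact congrFun h i

theorem length_space (F : ι →₀ ℤ) :
    Module.length k (S.space F) = relLength ⊥ (S.box F ⊓ S.constants) := by
  rw [← relLength_bot, ← relLength_map S.constMap_injective, Submodule.map_bot, space,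
    Submodule.map_comap_eq, inf_comm]
  rfl

/-- Split `box G / box F` along the constants: intersections measure the growth of `L`, sums the
drop of the obstruction. -/
theorem exists_length_space_eq_add {F G : ι →₀ ℤ} (h : F ≤ G) : ∃ a b : ℕ,
    S.degree G = S.degree F + a + b ∧
    Module.length k (S.space G) = Module.length k (S.space F) + a ∧
    S.obstruction F = b + S.obstruction G := by
  obtain ⟨d, hd, hdeg⟩ := S.exists_relLength_box h
  rw [relLength_eq_inf_add_sup (S.box_mono h) S.constants] at hd
  obtain ⟨a, ha, -⟩ := ENat.le_natCast_iff.mp (le_self_add.trans_eq hd)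
  obtain ⟨b, hb, -⟩ := ENat.le_natCast_iff.mp (le_add_self.trans_eq hd)
  refine ⟨a, b, ?_, ?_, ?_⟩
  · rw [ha, hb, ← Nat.cast_add, Nat.cast_inj] at hd
    rw [hdeg, ← hd]
    push_cast
    ring
  · rw [length_space, length_space, ← ha,
      ← relLength_add bot_le (inf_le_inf_right _ (S.box_mono h))]
  · rw [obstruction, obstruction, ← hb, ← relLength_add (sup_le_sup_right (S.box_mono h) _)
      (sup_le (S.box_le_adele G) S.constants_le_adele)]

/-- Riemann's form of the Riemann-Roch theorem. -/
theorem riemann_roch (hg : S.obstruction 0 = g) (F : ι →₀ ℤ) : ∃ l i : ℕ,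
    Module.length k (S.space F) = l ∧ S.obstruction F = i ∧
      (l : ℤ) - i = S.degree F + 1 - g := by
  -- `F` and `0` need not be comparable, so both are compared with their supremum.
  obtain ⟨a, b, h1, h2, h3⟩ := S.exists_length_space_eq_add (le_sup_right (a := F) (b := 0))
  obtain ⟨a', b', h1', h2', h3'⟩ := S.exists_length_space_eq_add (le_sup_left (a := F) (b := 0))
  rw [length_space_zero] at h2
  rw [hg] at h3
  obtain ⟨i, hi, -⟩ := ENat.le_natCast_iff.mp (le_add_self.trans_eq h3.symm)
  have hl : Module.length k (S.space (F ⊔ 0)) = (1 + a : ℕ) := by rw [h2]; simp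
  rw [hl] at h2'
  obtain ⟨l, hl', -⟩ := ENat.le_natCast_iff.mp (le_self_add.trans_eq h2'.symm)
  refine ⟨l, b' + i, hl', by rw [h3', hi]; simp, ?_⟩
  rw [hi, ← Nat.cast_add, Nat.cast_inj] at h3
  rw [hl', ← Nat.cast_add, Nat.cast_inj] at h2'
  rw [degree_zero] at h1
  push_cast
  omega

/-- A positive obstruction `i` would give `l ≤ g`, hence `deg F + 1 - g = l - i ≤ g - 1`, against
the degree bound. -/
theorem length_space_eq (hg : S.obstruction 0 = g) {F : ι →₀ ℤ}
    (hF : 2 * (g : ℤ) - 2 < S.degree F) :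
    ∃ l : ℕ, Module.length k (S.space F) = l ∧ (l : ℤ) = S.degree F + 1 - g := by
  obtain ⟨l, i, hl, hi, h⟩ := S.riemann_roch hg F
  refine ⟨l, hl, ?_⟩
  rcases Nat.eq_zero_or_pos i with rfl | hpos
  · simpa using h
  · have h1 := S.length_space_le_of_obstruction_ne_zero hg (F := F)
      (by rw [hi]; exact_mod_cast hpos.ne')
    rw [hl, Nat.cast_le] at h1
    omega

/-- No product formula is needed. A nonzero `s` in `L(E)` would multiply `L(-(2g+1)E)` injectively
into `L(-2gE)`. Both degrees exceed `2g - 2`, so `length_space_eq` makes the source larger by `-deg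
E > 0`. -/
theorem space_eq_bot (hg : S.obstruction 0 = g) {E : ι →₀ ℤ} (hE : S.degree E < 0) :
    S.space E = ⊥ := by
  rw [eq_bot_iff]
  intro s hs
  by_contra hs0
  rw [Submodule.mem_bot] at hs0
  have hdeg : ∀ m : ℕ, S.degree (m • (-E)) = m * (-S.degree E) := fun m => by
    rw [degree_nsmul, degree_neg]
  have hle : Module.length k (S.space ((2 * g + 1) • (-E))) ≤
      Module.length k (S.space ((2 * g) • (-E))) := by
    let f : S.space ((2 * g + 1) • (-E)) →ₗ[k] S.space ((2 * g) • (-E)) :=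
      (LinearMap.mulLeft k s).restrict fun t ht => S.mem_space.mpr fun i => by
        rw [LinearMap.mulLeft_apply, map_mul]
        refine (mul_le_mul' (S.mem_space.mp hs i) (S.mem_space.mp ht i)).trans_eq ?_
        rw [← exp_add, succ_nsmul, Finsupp.add_apply, Finsupp.neg_apply]
        congr 1
        ring
    exact Module.length_le_of_injective f fun t t' h =>
      Subtype.ext (mul_right_injective₀ hs0 (congrArg Subtype.val h))
  obtain ⟨l, hl, hl'⟩ := S.length_space_eq hg (F := (2 * g) • (-E))
    (by rw [hdeg]; push_cast; nlinarith)
  obtain ⟨l₁, hl₁, hl₁'⟩ := S.length_space_eq hg (F := (2 * g + 1) • (-E))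
    (by rw [hdeg]; push_cast; nlinarith)
  rw [hl, hl₁, Nat.cast_le] at hle
  rw [hdeg] at hl' hl₁'
  push_cast at hl' hl₁'
  have : (l₁ : ℤ) ≤ l := by exact_mod_cast hle
  linarith

end PlaceSystem

end ConvolutionalGoppa

/-! ### Commutative algebra for affine charts -/

namespace ConvolutionalGoppa

open AlgebraicGeometry CategoryTheory TopologicalSpace

/-- A nonzero prime below `q` extends to a nonzero prime of the discrete valuation ring `O`, that
is, to its maximal ideal, and so equals `q`. In a noetherian chart this leaves finitely many
candidates for the poles of `a / b`. -/
theorem mem_minimalPrimes_span_singleton {A O : Type*} [CommRing A] [IsDomain A] [CommRing O]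
    [IsDomain O] [IsDiscreteValuationRing O] [Algebra A O] (q : Ideal A) [hq : q.IsPrime]
    [IsLocalization.AtPrime O q] {b : A} (hb : b ≠ 0) (hbq : b ∈ q) :
    q ∈ (Ideal.span {b}).minimalPrimes := by
  refine ⟨⟨hq, (Ideal.span_singleton_le_iff_mem q).mpr hbq⟩, fun P ⟨hP, hbP⟩ hPq => ?_⟩
  have hdisj : Disjoint (q.primeCompl : Set A) (P : Set A) :=
    Set.disjoint_left.mpr fun a ha haP => ha (hPq haP)
  have hprime : (P.map (algebraMap A O)).IsPrime :=
    IsLocalization.isPrime_of_isPrime_disjoint q.primeCompl O P hP hdisj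
  have hinj : Function.Injective (algebraMap A O) :=
    IsLocalization.injective O q.primeCompl_le_nonZeroDivisors
  have hne : P.map (algebraMap A O) ≠ ⊥ := by
    rw [Ne, Ideal.map_eq_bot_iff_of_injective hinj]
    rintro rfl
    exact hb (by simpa using hbP)
  have hmax := hprime.isMaximal hne
  have hqne : q.map (algebraMap A O) ≠ ⊤ := by
    rw [IsLocalization.map_algebraMap_ne_top_iff_disjoint q.primeCompl O]
    exact Set.disjoint_left.mpr fun a ha haq => ha haq
  have hle : q.map (algebraMap A O) = P.map (algebraMap A O) :=
    (hmax.eq_of_le hqne (Ideal.map_mono hPq)).symm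
  have hcomap := IsLocalization.under_map_of_isPrime_disjoint q.primeCompl O hP hdisj
  rw [← hcomap, ← hle]
  exact Ideal.le_comap_map

/-- The fraction field of an étale algebra over a domain has finite rank over that domain. -/
theorem exists_maximal_linearIndependent_of_etale {R A K : Type*} [CommRing R] [IsDomain R]
    [CommRing A] [Algebra R A] [Algebra.Etale R A] [Field K] [Algebra A K] [IsFractionRing A K]
    [Algebra R K] [IsScalarTower R A K] [FaithfulSMul R K] :
    ∃ (n : ℕ) (u : Fin n → K), LinearIndependent R u ∧
      ∀ (m : ℕ) (w : Fin m → K), LinearIndependent R w → m ≤ n := by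
  let Q := FractionRing R
  let := FractionRing.liftAlgebra R K
  have : IsScalarTower R Q K := FractionRing.isScalarTower_liftAlgebra R K
  have : Algebra.EssFiniteType A K := .of_isLocalization _ (nonZeroDivisors A)
  have : Algebra.EssFiniteType R K := .comp R A K
  have : Algebra.EssFiniteType Q K := .of_comp R Q K
  have : Algebra.FormallyUnramified A K := .of_isLocalization (nonZeroDivisors A)
  have : Algebra.FormallyUnramified R K := .comp R A K
  have : Algebra.FormallyUnramified Q K := .of_restrictScalars R Q K
  -- Over a field, an unramified algebra essentially of finite type is finite.
  have : Module.Finite Q K := Algebra.FormallyUnramified.finite_of_free Q K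
  refine ⟨Module.finrank Q K, Module.finBasis Q K, ?_, fun m w hw => ?_⟩
  · rw [LinearIndependent.iff_fractionRing R Q]
    exact (Module.finBasis Q K).linearIndependent
  · rw [LinearIndependent.iff_fractionRing R Q] at hw
    simpa using hw.fintype_card_le_finrank

theorem injective_algebraMap_of_flat {R A : Type*} [CommRing R] [IsDomain R] [CommRing A]
    [Nontrivial A] [Algebra R A] [Module.Flat R A] : Function.Injective (algebraMap R A) := by
  rw [injective_iff_map_eq_zero]
  intro a ha
  by_contra h
  have := (Module.Flat.isSMulRegular_of_nonZeroDivisors (M := A)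
    (mem_nonZeroDivisors_of_ne_zero h))
  have h1 : a • (1 : A) = a • (0 : A) := by rw [Algebra.smul_def, ha]; simp
  exact one_ne_zero (this h1)

end ConvolutionalGoppa

/-! ### Global sections are constants -/

namespace ConvolutionalGoppa

open AlgebraicGeometry CategoryTheory TopologicalSpace

/-- The difference `f a - g a` is integral over `k` in a domain, so it is zero or a unit; `μ` sends
it to `0`, so it is not a unit. -/
theorem ringHom_eq_of_isIntegral_of_common_retraction {k L D : Type*} [Field k] [CommRing L]
    [Nontrivial L] [Algebra k L] [Algebra.IsIntegral k L] [CommRing D] [IsDomain D]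
    {f g : L →+* D} (hfg : f.comp (algebraMap k L) = g.comp (algebraMap k L)) {μ : D →+* L}
    (hf : μ.comp f = RingHom.id L) (hg : μ.comp g = RingHom.id L) : f = g := by
  let := (f.comp (algebraMap k L)).toAlgebra
  let f' : L →ₐ[k] D := ⟨f, fun _ => rfl⟩
  let g' : L →ₐ[k] D := ⟨g, fun c => (RingHom.congr_fun hfg c).symm⟩
  ext a
  by_contra hne
  have hint : _root_.IsIntegral k (f' a - g' a) :=
    ((Algebra.IsIntegral.isIntegral a).map f').sub ((Algebra.IsIntegral.isIntegral a).map g')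
  have hu := (hint.isUnit (sub_ne_zero.mpr hne)).map μ
  have h0 : μ (f' a - g' a) = 0 := by
    rw [map_sub, sub_eq_zero]
    exact (RingHom.congr_fun hf a).trans (RingHom.congr_fun hg a).symm
  rw [h0] at hu
  exact not_isUnit_zero hu

theorem appLE_top_top {X Y : Scheme.{u}} (f : X ⟶ Y) (h : ⊤ ≤ f ⁻¹ᵁ ⊤) :
    f.appLE ⊤ ⊤ h = f.appTop :=
  (f.app_eq_appLE (U := ⊤)).symm

namespace SmoothProjectiveCurve

variable {k : Type u} [Field k] (C : SmoothProjectiveCurve k)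

/-- The structure map `k → Γ(X, O_X)`. -/
abbrev toGlobalSections : CommRingCat.of k ⟶ Γ(C.X, ⊤) :=
  (Scheme.ΓSpecIso (CommRingCat.of k)).inv ≫ C.hom.appTop

theorem finite_toGlobalSections : C.toGlobalSections.hom.Finite := by
  have h := finite_appTop_of_universallyClosed k C.hom
  refine RingHom.Finite.comp h (RingHom.Finite.of_surjective _ ?_)
  exact (Scheme.ΓSpecIso (CommRingCat.of k)).symm.commRingCatIsoToRingEquiv.surjective

/-- Base change `X` along `k → Γ`, with `Γ` the field of global sections. The result is integral by
geometric integrality, and by flat base change its global sections are `Γ ⊗ Γ`, which is therefore a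
domain. Multiplication retracts both inclusions of `Γ`, so they coincide, and this says that `k → Γ`
is an epimorphism. -/
theorem epi_toGlobalSections : Epi C.toGlobalSections := by
  let Γ := Γ(C.X, ⊤)
  let := (isField_of_universallyClosed k C.hom).toField
  let f : Spec Γ ⟶ Spec (CommRingCat.of k) := Spec.map C.toGlobalSections
  let H := IsPullback.of_hasPullback C.hom f
  have hint : IsIntegral (Limits.pullback C.hom f) :=
    GeometricallyIntegral.geometrically_isIntegral (f := C.hom) (K := Γ) f _ _ H
  have : QuasiCompact C.hom := inferInstance
  have : CompactSpace C.X := (quasiCompact_iff_compactSpace C.hom).mp inferInstance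
  have : QuasiSeparatedSpace C.X := (quasiSeparated_iff_quasiSeparatedSpace C.hom).mp inferInstance
  have hiso := isIso_pushoutSection_of_isQuasiSeparated_of_flat_right H
    (US := ⊤) (UT := ⊤) (UX := ⊤) (UY := ⊤) le_top le_top (by simp) (isAffineOpen_top _)
    (isAffineOpen_top _) isCompact_univ isQuasiSeparated_univ
  have hp : IsPushout C.hom.appTop f.appTop (Limits.pullback.fst C.hom f).appTop
      (Limits.pullback.snd C.hom f).appTop := by
    convert (isIso_pushoutSection_iff _ _ _ _).mp hiso using 1 <;>
      exact (appLE_top_top _ _).symm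
  set g := Limits.pullback.fst C.hom f
  set i := Limits.pullback.snd C.hom f
  have hf : f.appTop = (Scheme.ΓSpecIso (CommRingCat.of k)).hom ≫ C.toGlobalSections ≫
      (Scheme.ΓSpecIso Γ).inv := by
    rw [← Category.assoc, Iso.eq_comp_inv, ← Scheme.ΓSpecIso_naturality]
  have hC : C.hom.appTop = (Scheme.ΓSpecIso (CommRingCat.of k)).hom ≫ C.toGlobalSections :=
    (Iso.hom_inv_id_assoc _ _).symm
  have hdesc : ∀ {R : CommRingCat.{u}} (a b : Γ ⟶ R),
      C.toGlobalSections ≫ a = C.toGlobalSections ≫ b →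
      ∃ w : Γ(Limits.pullback C.hom f, ⊤) ⟶ R, g.appTop ≫ w = a ∧
        ((Scheme.ΓSpecIso Γ).inv ≫ i.appTop) ≫ w = b := by
    intro R a b hab
    refine ⟨hp.desc a ((Scheme.ΓSpecIso Γ).hom ≫ b) ?_, hp.inl_desc _ _ _, ?_⟩
    · rw [hf, Category.assoc, Category.assoc, Iso.inv_hom_id_assoc, ← hab, ← Category.assoc, ← hC]
    · rw [Category.assoc, hp.inr_desc, Iso.inv_hom_id_assoc]
  -- `μ` is the multiplication map `Γ ⊗ Γ → Γ`.
  obtain ⟨μ, hμ₁, hμ₂⟩ := hdesc (𝟙 Γ) (𝟙 Γ) rfl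
  algebraize [C.toGlobalSections.hom]
  have : Algebra.IsIntegral k Γ := ⟨C.finite_toGlobalSections.to_isIntegral⟩
  have hw : C.toGlobalSections ≫ g.appTop =
      C.toGlobalSections ≫ (Scheme.ΓSpecIso Γ).inv ≫ i.appTop := by
    rw [← cancel_epi (Scheme.ΓSpecIso (CommRingCat.of k)).hom, ← Category.assoc, ← hC, hp.w, hf]
    simp only [Category.assoc]
  have key : g.appTop = (Scheme.ΓSpecIso Γ).inv ≫ i.appTop := by
    ext1
    exact ringHom_eq_of_isIntegral_of_common_retraction (k := k) (L := Γ) (μ := μ.hom)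
      (congrArg CommRingCat.Hom.hom hw) (congrArg CommRingCat.Hom.hom hμ₁)
      (congrArg CommRingCat.Hom.hom hμ₂)
  refine ⟨fun {R} a b hab => ?_⟩
  obtain ⟨w, rfl, rfl⟩ := hdesc a b hab
  rw [key]

theorem surjective_toGlobalSections : Function.Surjective C.toGlobalSections.hom :=
  have := C.epi_toGlobalSections
  RingHom.surjective_of_epi_of_finite C.toGlobalSections C.finite_toGlobalSections

end SmoothProjectiveCurve

end ConvolutionalGoppa

/-! ### Residue fields and poles on affine charts -/

namespace ConvolutionalGoppa

open AlgebraicGeometry CategoryTheory TopologicalSpace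

namespace SmoothProjectiveCurve

variable {k : Type u} [Field k] (C : SmoothProjectiveCurve k)

/-- The structure map `k → Γ(V, O_X)`. -/
abbrev toSections (V : C.X.Opens) : CommRingCat.of k ⟶ Γ(C.X, V) :=
  C.toGlobalSections ≫ C.X.presheaf.map (homOfLE le_top).op

instance algebraSections (V : C.X.Opens) : Algebra k Γ(C.X, V) := (C.toSections V).hom.toAlgebra

theorem algebraMap_localRing (V : C.X.Opens) (x : C.X) (hx : x ∈ V) (c : k) :
    algebraMap k (C.LocalRing x) c = C.X.presheaf.germ V x hx (algebraMap k Γ(C.X, V) c) := by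
  have h := C.X.presheaf.germ_res (homOfLE (le_top (a := V))) x hx
  have h2 := congrArg (fun f => C.toGlobalSections ≫ f) h
  exact (RingHom.congr_fun (congrArg CommRingCat.Hom.hom h2) c).symm

theorem finiteType_sections {V : C.X.Opens} (hV : IsAffineOpen V) :
    Algebra.FiniteType k Γ(C.X, V) := by
  have h := C.hom.finiteType_appLE (isAffineOpen_top _) hV le_top
  have h2 := h.comp (RingHom.FiniteType.of_surjective
    (Scheme.ΓSpecIso (CommRingCat.of k)).inv.hom
    (Scheme.ΓSpecIso (CommRingCat.of k)).symm.commRingCatIsoToRingEquiv.surjective)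
  exact h2

theorem exists_chart (x : C.X) : ∃ V : C.X.Opens, IsAffineOpen V ∧ x ∈ V ∧
    Algebra.IsStandardSmoothOfRelativeDimension 1 k Γ(C.X, V) := by
  obtain ⟨U, hU, V, hV, hxV, e, hs⟩ :=
    SmoothOfRelativeDimension.exists_isStandardSmoothOfRelativeDimension (n := 1) (f := C.hom) x
  have hUt : U = ⊤ := by
    ext y
    simp only [Opens.coe_top, Set.mem_univ, iff_true]
    exact Subsingleton.elim (C.hom x) y ▸ e hxV
  subst hUt
  refine ⟨V, hV, hxV, ?_⟩
  have h2 := RingHom.isStandardSmoothOfRelativeDimension_respectsIso.2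
    (C.hom.appLE ⊤ V e).hom (Scheme.ΓSpecIso (CommRingCat.of k)).symm.commRingCatIsoToRingEquiv hs
  exact h2

variable {C}

theorem ClosedPoint.finite_residueField (x : C.ClosedPoint) : Module.Finite k x.κ := by
  obtain ⟨V, hV, hx, hs⟩ := C.exists_chart x.1
  have := C.finiteType_sections hV
  have hmax := hV.primeIdealOf_isMaximal_of_isClosed ⟨x.1, hx⟩ x.2
  have hloc := hV.isLocalization_stalk ⟨x.1, hx⟩
  let := TopCat.Presheaf.algebra_section_stalk C.X.presheaf (⟨x.1, hx⟩ : V)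
  let q := (hV.primeIdealOf ⟨x.1, hx⟩).asIdeal
  have hsurj : Function.Surjective ((IsLocalRing.residue x.O).comp
      (algebraMap Γ(C.X, V) x.O)) :=
    (IsLocalization.AtPrime.equivQuotMaximalIdeal q x.O).surjective.comp
      Ideal.Quotient.mk_surjective
  let f : Γ(C.X, V) →ₐ[k] x.κ :=
    { (IsLocalRing.residue x.O).comp (algebraMap Γ(C.X, V) x.O) with
      commutes' := fun c => by
        exact congrArg (IsLocalRing.residue x.O) (C.algebraMap_localRing V x.1 hx c).symm }
  have : Algebra.FiniteType k x.κ := .of_surjective f hsurj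
  exact finite_of_finite_type_of_isJacobsonRing k x.κ

theorem ClosedPoint.exists_mul_eq_of_valuation_le_one (x : C.ClosedPoint) {V : C.X.Opens}
    [Nonempty V] (hV : IsAffineOpen V) (hx : x.1 ∈ V) {s : C.FunctionField}
    (hs : x.valuation s ≤ 1) : ∃ a b : Γ(C.X, V), b ∉ (hV.primeIdealOf ⟨x.1, hx⟩).asIdeal ∧
      algebraMap Γ(C.X, V) C.FunctionField b * s = algebraMap Γ(C.X, V) C.FunctionField a := by
  obtain ⟨t, rfl⟩ := IsDiscreteValuationRing.exists_lift_of_le_one hs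
  have hloc := hV.isLocalization_stalk ⟨x.1, hx⟩
  let := TopCat.Presheaf.algebra_section_stalk C.X.presheaf (⟨x.1, hx⟩ : V)
  have htower := functionField_isScalarTower C.X V ⟨x.1, hx⟩
  obtain ⟨⟨a, b⟩, h⟩ := IsLocalization.surj
    (hV.primeIdealOf ⟨x.1, hx⟩).asIdeal.primeCompl t
  refine ⟨a, b, b.2, ?_⟩
  rw [IsScalarTower.algebraMap_apply Γ(C.X, V) (C.LocalRing x.1) C.FunctionField a,
    IsScalarTower.algebraMap_apply Γ(C.X, V) (C.LocalRing x.1) C.FunctionField b, ← map_mul,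
    mul_comm, h]

theorem ClosedPoint.valuation_le_one_of_mul_eq (x : C.ClosedPoint) {V : C.X.Opens}
    [Nonempty V] (hV : IsAffineOpen V) (hx : x.1 ∈ V) {s : C.FunctionField} {a b : Γ(C.X, V)}
    (hb : b ∉ (hV.primeIdealOf ⟨x.1, hx⟩).asIdeal)
    (h : algebraMap Γ(C.X, V) C.FunctionField b * s = algebraMap Γ(C.X, V) C.FunctionField a) :
    x.valuation s ≤ 1 := by
  have hloc := hV.isLocalization_stalk ⟨x.1, hx⟩
  let := TopCat.Presheaf.algebra_section_stalk C.X.presheaf (⟨x.1, hx⟩ : V)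
  have htower := functionField_isScalarTower C.X V ⟨x.1, hx⟩
  have hu : IsUnit (algebraMap Γ(C.X, V) (C.LocalRing x.1) b) :=
    IsLocalization.map_units (M := (hV.primeIdealOf ⟨x.1, hx⟩).asIdeal.primeCompl) _ ⟨b, hb⟩
  obtain ⟨c, hc⟩ := hu.exists_right_inv
  have hs : s = algebraMap (C.LocalRing x.1) C.FunctionField
      (c * algebraMap Γ(C.X, V) (C.LocalRing x.1) a) := by
    rw [map_mul, ← IsScalarTower.algebraMap_apply, ← h,
      IsScalarTower.algebraMap_apply Γ(C.X, V) (C.LocalRing x.1) C.FunctionField b, ← mul_assoc,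
      ← map_mul, mul_comm c, hc, map_one, one_mul]
  rw [hs]
  exact x.valuation_le_one _

/-- A rational function has finitely many poles on an affine open subset. -/
theorem finite_poles_of_isAffineOpen {V : C.X.Opens} (hV : IsAffineOpen V)
    (s : C.FunctionField) : {x : C.ClosedPoint | x.1 ∈ V ∧ ¬ x.valuation s ≤ 1}.Finite := by
  classical
  rcases isEmpty_or_nonempty V with hVe | hVn
  · refine Set.finite_empty.subset fun x hx => hVe.elim ⟨x.1, hx.1⟩
  have := C.finiteType_sections hV
  have : IsNoetherianRing Γ(C.X, V) := Algebra.FiniteType.isNoetherianRing k _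
  have := functionField_isFractionRing_of_isAffineOpen C.X V hV
  obtain ⟨a, b, hb, hab⟩ := IsFractionRing.div_surjective (A := Γ(C.X, V)) s
  have hb0 : b ≠ 0 := nonZeroDivisors.ne_zero hb
  have hfin := Ideal.finite_minimalPrimes_of_isNoetherianRing Γ(C.X, V) (Ideal.span {b})
  have hb' : algebraMap Γ(C.X, V) C.FunctionField b ≠ 0 :=
    IsFractionRing.to_map_ne_zero_of_mem_nonZeroDivisors hb
  have hmem : ∀ (x : C.ClosedPoint) (hx : x.1 ∈ V), ¬ x.valuation s ≤ 1 →
      (hV.primeIdealOf ⟨x.1, hx⟩).asIdeal ∈ (Ideal.span {b}).minimalPrimes := by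
    intro x hx hs
    have hloc := hV.isLocalization_stalk ⟨x.1, hx⟩
    let := TopCat.Presheaf.algebra_section_stalk C.X.presheaf (⟨x.1, hx⟩ : V)
    refine mem_minimalPrimes_span_singleton (O := x.O) _ hb0 ?_
    by_contra hbq
    refine hs (x.valuation_le_one_of_mul_eq hV hx (a := a) hbq ?_)
    rw [← hab]
    field_simp
  refine Set.Finite.of_finite_image (f := fun x : C.ClosedPoint =>
    if hx : x.1 ∈ V then (hV.primeIdealOf ⟨x.1, hx⟩).asIdeal else ⊥) (hfin.subset ?_) ?_
  · rintro _ ⟨x, ⟨hx, hs⟩, rfl⟩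
    simp only [hx, dif_pos]
    exact hmem x hx hs
  -- A point of `V` is recovered from its prime ideal, so finitely many primes mean finitely many
  -- poles.
  · rintro x ⟨hx, -⟩ y ⟨hy, -⟩ hxy
    simp only [hx, hy, dif_pos] at hxy
    have h1 : hV.primeIdealOf ⟨x.1, hx⟩ = hV.primeIdealOf ⟨y.1, hy⟩ := PrimeSpectrum.ext hxy
    have h2 := congrArg hV.fromSpec h1
    rw [hV.fromSpec_primeIdealOf, hV.fromSpec_primeIdealOf] at h2
    exact Subtype.ext h2

instance : CompactSpace C.X := (quasiCompact_iff_compactSpace C.hom).mp inferInstance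

theorem finite_poles (s : C.FunctionField) :
    {x : C.ClosedPoint | ¬ x.valuation s ≤ 1}.Finite := by
  obtain ⟨I, hI, hcover⟩ := isCompact_iff_finite_and_eq_biUnion_affineOpens
    (U := (⊤ : C.X.Opens)).mp isCompact_univ
  refine (hI.biUnion fun V _ => finite_poles_of_isAffineOpen V.2 s).subset fun x hx => ?_
  have hx' : x.1 ∈ (⊤ : C.X.Opens) := trivial
  rw [hcover] at hx'
  simp only [Opens.mem_iSup] at hx'
  obtain ⟨V, hVI, hxV⟩ := hx'
  exact Set.mem_biUnion hVI ⟨hxV, hx⟩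

end SmoothProjectiveCurve

end ConvolutionalGoppa

/-! ### Separatedness, and rational functions without poles -/

namespace ConvolutionalGoppa

open AlgebraicGeometry CategoryTheory TopologicalSpace

namespace SmoothProjectiveCurve

variable {k : Type u} [Field k] {C : SmoothProjectiveCurve k}

/-- The uniqueness behind the valuative criterion: the two maps `Spec O_y → X`, direct and through
`Spec O_x`, agree on the dense generic point, hence everywhere as `X` is separated. So `y` lies in
the image of `Spec O_x`, the set of generizations of `x`. -/
theorem specializes_of_ringHom {x y : C.X} (φ : C.LocalRing x →+* C.LocalRing y)
    (hφ : (algebraMap (C.LocalRing y) C.FunctionField).comp φ =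
      algebraMap (C.LocalRing x) C.FunctionField) : y ⤳ x := by
  have hgx := (genericPoint_spec C.X).specializes (Set.mem_univ x)
  have hgy := (genericPoint_spec C.X).specializes (Set.mem_univ y)
  let ψ : C.X.presheaf.stalk x ⟶ C.X.presheaf.stalk y := CommRingCat.ofHom φ
  have hψ : ψ ≫ C.X.presheaf.stalkSpecializes hgy = C.X.presheaf.stalkSpecializes hgx :=
    CommRingCat.hom_ext hφ
  let ι := Spec.map (C.X.presheaf.stalkSpecializes hgy)
  have hdom : IsDominant ι := by
    refine ⟨(PrimeSpectrum.denseRange_comap_iff_ker_le_nilRadical _).mpr ?_⟩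
    refine le_of_eq_of_le ((RingHom.injective_iff_ker_eq_bot _).mp ?_) bot_le
    exact IsFractionRing.injective (C.LocalRing y) C.FunctionField
  have hι : ι ≫ Spec.map ψ ≫ C.X.fromSpecStalk x = ι ≫ C.X.fromSpecStalk y := by
    rw [← Category.assoc, ← Spec.map_comp, hψ, Scheme.SpecMap_stalkSpecializes_fromSpecStalk,
      Scheme.SpecMap_stalkSpecializes_fromSpecStalk]
  have hsep : C.X.IsSeparated := by
    rw [Scheme.isSeparated_iff, ← Limits.terminal.comp_from C.hom]
    infer_instance
  have heq := ext_of_isDominant ι hι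
  have hy : y ∈ Set.range (C.X.fromSpecStalk x) := by
    refine ⟨Spec.map ψ (IsLocalRing.closedPoint (C.X.presheaf.stalk y)), ?_⟩
    exact (congrArg (fun f => f (IsLocalRing.closedPoint (C.X.presheaf.stalk y))) heq).trans
      Scheme.fromSpecStalk_closedPoint
  rwa [Scheme.range_fromSpecStalk] at hy

/-- Otherwise `O_x ⊆ O_y` inside the function field, so `y` specializes to `x`, which is impossible
for distinct closed points. -/
theorem ClosedPoint.incomparable {x y : C.ClosedPoint} (hxy : x ≠ y) :
    ∃ s, x.valuation s ≤ 1 ∧ 1 < y.valuation s := by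
  by_contra! h
  have hmem : ∀ a : x.O, ∃ b : y.O, algebraMap y.O C.FunctionField b =
      algebraMap x.O C.FunctionField a := fun a =>
    IsDiscreteValuationRing.exists_lift_of_le_one (h _ (x.valuation_le_one a))
  have hinj := IsFractionRing.injective y.O C.FunctionField
  let e := RingEquiv.ofBijective (algebraMap y.O C.FunctionField).rangeRestrict
    ⟨fun a b hab => hinj (congrArg Subtype.val hab), RingHom.rangeRestrict_surjective _⟩
  let φ : x.O →+* y.O := (e.symm : _ →+* y.O).comp
    ((algebraMap x.O C.FunctionField).codRestrict (algebraMap y.O C.FunctionField).range hmem)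
  have hs : y.1 ⤳ x.1 := specializes_of_ringHom φ <| by
    ext a
    have := e.apply_symm_apply ⟨algebraMap x.O C.FunctionField a, hmem a⟩
    exact congrArg Subtype.val this
  have := hs.mem_closed y.2 rfl
  exact hxy (Subtype.ext this)

theorem exists_closedPoint_of_isMaximal {V : C.X.Opens} (hV : IsAffineOpen V)
    (q : Ideal Γ(C.X, V)) (hq : q.IsMaximal) :
    ∃ (x : C.ClosedPoint) (hx : x.1 ∈ V), (hV.primeIdealOf ⟨x.1, hx⟩).asIdeal = q := by
  let z : PrimeSpectrum Γ(C.X, V) := ⟨q, hq.isPrime⟩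
  -- The Jacobson property makes a closed point of the open set `V` closed in all of `X`.
  have : JacobsonSpace C.X := LocallyOfFiniteType.jacobsonSpace C.hom
  have hz : z ∈ closedPoints (PrimeSpectrum Γ(C.X, V)) :=
    (PrimeSpectrum.isClosed_singleton_iff_isMaximal z).mpr hq
  have hopen := hV.fromSpec.isOpenEmbedding
  have hcl : IsClosed {hV.fromSpec z} := by
    exact (Set.ext_iff.mp hopen.preimage_closedPoints z).mpr hz
  have hmem : hV.fromSpec z ∈ V := by
    have : hV.fromSpec z ∈ Set.range hV.fromSpec := ⟨z, rfl⟩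
    rwa [hV.range_fromSpec] at this
  refine ⟨⟨hV.fromSpec z, hcl⟩, hmem, ?_⟩
  have : hV.primeIdealOf ⟨hV.fromSpec z, hmem⟩ = z := by
    apply hopen.injective
    exact hV.fromSpec_primeIdealOf _
  exact congrArg PrimeSpectrum.asIdeal this

theorem exists_section_of_isAffineOpen {V : C.X.Opens} [Nonempty V] (hV : IsAffineOpen V)
    {s : C.FunctionField} (hs : ∀ x : C.ClosedPoint, x.valuation s ≤ 1) :
    ∃ a : Γ(C.X, V), algebraMap Γ(C.X, V) C.FunctionField a = s := by
  -- The ideal of denominators of `s`. Regularity at the closed point of a maximal ideal provides a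
  -- denominator outside that ideal, so `J` is the unit ideal.
  let J : Ideal Γ(C.X, V) :=
    { carrier := {b | ∃ a, algebraMap Γ(C.X, V) C.FunctionField b * s =
        algebraMap Γ(C.X, V) C.FunctionField a}
      zero_mem' := ⟨0, by simp⟩
      add_mem' := by
        rintro b c ⟨a, ha⟩ ⟨d, hd⟩
        exact ⟨a + d, by rw [map_add, map_add, add_mul, ha, hd]⟩
      smul_mem' := by
        rintro c b ⟨a, ha⟩
        exact ⟨c * a, by rw [smul_eq_mul, map_mul, map_mul, mul_assoc, ha]⟩ }
  have hJ : J = ⊤ := by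
    by_contra hne
    obtain ⟨q, hq, hJq⟩ := Ideal.exists_le_maximal J hne
    obtain ⟨x, hx, rfl⟩ := exists_closedPoint_of_isMaximal hV q hq
    obtain ⟨a, b, hb, hab⟩ := x.exists_mul_eq_of_valuation_le_one hV hx (hs x)
    exact hb (hJq ⟨a, hab⟩)
  obtain ⟨a, ha⟩ : (1 : Γ(C.X, V)) ∈ J := hJ ▸ Submodule.mem_top
  exact ⟨a, by rw [← ha, map_one, one_mul]⟩

theorem algebraMap_sections (V : C.X.Opens) [Nonempty V] (c : k) :
    algebraMap Γ(C.X, V) C.FunctionField (algebraMap k Γ(C.X, V) c) =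
      algebraMap k C.FunctionField c :=
  (C.algebraMap_localRing V (genericPoint C.X)
    (((genericPoint_spec C.X).mem_open_set_iff V.isOpen).mpr (by simpa using ‹Nonempty V›)) c).symm

theorem germToFunctionField_map {U V : C.X.Opens} [Nonempty U] [Nonempty V] (i : U ⟶ V)
    (a : Γ(C.X, V)) : C.X.germToFunctionField U (C.X.presheaf.map i.op a) =
      C.X.germToFunctionField V a :=
  C.X.presheaf.germ_res_apply i _ _ a

/-- The rational functions without poles on a smooth projective curve are the constants. -/
theorem mem_range_algebraMap_of_valuation_le_one {s : C.FunctionField}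
    (hs : ∀ x : C.ClosedPoint, x.valuation s ≤ 1) :
    s ∈ Set.range (algebraMap k C.FunctionField) := by
  choose W hW hxW _ using C.exists_chart
  have hne : ∀ x, Nonempty (W x) := fun x => ⟨⟨x, hxW x⟩⟩
  choose f hf using fun x => exists_section_of_isAffineOpen (hW x) hs
  -- All local sections have image `s` in the function field, so they agree on overlaps, which
  -- contain the generic point, and glue to a global section.
  have hcompat : TopCat.Presheaf.IsCompatible C.X.sheaf.1 W f := by
    intro x y
    let Wxy : C.X.Opens := W x ⊓ W y
    have hxy : Nonempty Wxy := by
      have h := (genericPoint_spec C.X)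
      refine ⟨⟨genericPoint C.X, ?_, ?_⟩⟩
      · exact (h.mem_open_set_iff (W x).isOpen).mpr ⟨x, trivial, hxW x⟩
      · exact (h.mem_open_set_iff (W y).isOpen).mpr ⟨y, trivial, hxW y⟩
    apply C.X.germToFunctionField_injective Wxy
    exact (germToFunctionField_map _ _).trans
      ((hf x).trans ((hf y).symm.trans (germToFunctionField_map _ _).symm))
  obtain ⟨t, ht, -⟩ := C.X.sheaf.existsUnique_gluing' W ⊤ (fun x => homOfLE le_top)
    (fun x _ => Opens.mem_iSup.mpr ⟨x, hxW x⟩) f hcompat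
  obtain ⟨c, hc⟩ := C.surjective_toGlobalSections t
  refine ⟨c, ?_⟩
  let x := genericPoint C.X
  rw [← algebraMap_sections (W x), ← hf x]
  refine congrArg _ (Eq.trans ?_ (ht x))
  exact congrArg (C.X.presheaf.map (homOfLE le_top).op) hc

end SmoothProjectiveCurve

end ConvolutionalGoppa

/-! ### The place system of a curve, and the dimension of `L(G)` -/

namespace ConvolutionalGoppa

open AlgebraicGeometry CategoryTheory TopologicalSpace WithZero Polynomial

namespace SmoothProjectiveCurve

variable {k : Type u} [Field k] {C : SmoothProjectiveCurve k}

theorem ClosedPoint.valuation_algebraMap_le_one (x : C.ClosedPoint) (c : k) :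
    x.valuation (algebraMap k C.FunctionField c) ≤ 1 := by
  rw [IsScalarTower.algebraMap_apply k x.O C.FunctionField]
  exact x.valuation_le_one _

theorem ClosedPoint.residue_eq_zero_iff (x : C.ClosedPoint) (a : x.O) :
    algebraMap x.O x.κ a = 0 ↔ x.valuation (algebraMap x.O C.FunctionField a) ≤ exp (-1) := by
  rw [IsLocalRing.ResidueField.algebraMap_eq, IsLocalRing.residue_eq_zero_iff]
  rw [← lt_mul_exp_iff_le exp_ne_zero, ← exp_add, neg_add_cancel, exp_zero]
  exact (IsDedekindDomain.HeightOneSpectrum.valuation_lt_one_iff_mem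
    (IsDiscreteValuationRing.maximalIdeal x.O) a).symm

theorem ClosedPoint.length_residue (x : C.ClosedPoint) :
    relLength (valuationBall x.valuation x.valuation_algebraMap_le_one (-1))
      (valuationBall x.valuation x.valuation_algebraMap_le_one 0) = Module.finrank k x.κ := by
  have := x.finite_residueField
  let f : x.O →ₗ[k] C.FunctionField := (IsScalarTower.toAlgHom k x.O C.FunctionField).toLinearMap
  have hf : Function.Injective f := IsFractionRing.injective x.O C.FunctionField
  let g : x.O →ₗ[k] x.κ := (IsScalarTower.toAlgHom k x.O x.κ).toLinearMap
  have hg : Function.Surjective g := IsLocalRing.residue_surjective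
  have h0 : valuationBall x.valuation x.valuation_algebraMap_le_one 0 =
      (⊤ : Submodule k x.O).map f := by
    ext s
    rw [Submodule.map_top]
    constructor
    · intro hs
      exact IsDiscreteValuationRing.exists_lift_of_le_one hs
    · rintro ⟨a, rfl⟩
      exact x.valuation_le_one a
  have h1 : valuationBall x.valuation x.valuation_algebraMap_le_one (-1) =
      (LinearMap.ker g).map f := by
    ext s
    constructor
    · intro hs
      obtain ⟨a, rfl⟩ := IsDiscreteValuationRing.exists_lift_of_le_one
        (hs.trans (exp_le_exp.mpr (by decide : (-1 : ℤ) ≤ 0)))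
      exact ⟨a, (x.residue_eq_zero_iff a).mpr hs, rfl⟩
    · rintro ⟨a, ha, rfl⟩
      exact (x.residue_eq_zero_iff a).mp ha
  rw [h0, h1, relLength_map hf,
    relLength_eq_length_of_surjective (g ∘ₗ (⊤ : Submodule k x.O).subtype), Module.length_eq_finrank]
  · exact fun y => (hg y).imp' (fun a => ⟨a, trivial⟩) fun a ha => ha
  · rw [LinearMap.ker_comp]

variable (C)

/-- The closed points of a smooth projective curve, as places of its function field. -/
def placeSystem : PlaceSystem k C.FunctionField C.ClosedPoint where
  val := ClosedPoint.valuation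
  residueDegree x := Module.finrank k x.κ
  val_algebraMap_le_one := ClosedPoint.valuation_algebraMap_le_one
  exists_val_eq x := IsDedekindDomain.HeightOneSpectrum.valuation_exists_uniformizer C.FunctionField
    (IsDiscreteValuationRing.maximalIdeal x.O)
  finite_poles := finite_poles
  length_residue := ClosedPoint.length_residue
  incomparable _ _ := ClosedPoint.incomparable
  mem_range_of_forall_le_one _ := mem_range_algebraMap_of_valuation_le_one

theorem repartition_eq : C.repartition = C.placeSystem.adele := by
  ext r
  have h : ∀ x : C.ClosedPoint, r x ∉ x.regular ↔ ¬ x.valuation (r x) ≤ 1 := fun x =>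
    not_congr ⟨fun ⟨a, ha⟩ => ha ▸ x.valuation_le_one a, x.mem_regular_of_valuation_le_one⟩
  change {x | r x ∉ x.regular}.Finite ↔ {x : C.ClosedPoint | ¬ x.valuation (r x) ≤ 1}.Finite
  simp only [h]

theorem integralRepartition_eq : C.integralRepartition = C.placeSystem.box 0 := by
  ext r
  rw [PlaceSystem.mem_box, integralRepartition, Submodule.mem_pi]
  refine ⟨fun h x => ?_, fun h x _ => x.mem_regular_of_valuation_le_one (h x)⟩
  obtain ⟨a, ha⟩ := h x trivial
  exact ha ▸ x.valuation_le_one a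

/-- The function field is the fraction field of an algebra étale over a polynomial ring. -/
theorem exists_etale_polynomial_isFractionRing : ∃ (A : Type u) (_ : CommRing A) (_ : Algebra k A)
    (_ : Algebra A C.FunctionField) (_ : Algebra k[X] A),
    IsScalarTower k A C.FunctionField ∧ IsScalarTower k k[X] A ∧ Algebra.Etale k[X] A ∧
      IsFractionRing A C.FunctionField := by
  obtain ⟨V, hV, hxV, _⟩ := C.exists_chart (genericPoint C.X)
  have : Nonempty V := ⟨⟨_, hxV⟩⟩
  obtain ⟨g, hg⟩ :=
    Algebra.IsStandardSmoothOfRelativeDimension.exists_etale_mvPolynomial 1 k Γ(C.X, V)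
  let h : k[X] →ₐ[k] Γ(C.X, V) := g.comp (MvPolynomial.uniqueAlgEquiv k (Fin 1)).symm.toAlgHom
  have hh : h.toRingHom.Etale :=
    RingHom.Etale.respectsIso.2 (g : MvPolynomial (Fin 1) k →+* Γ(C.X, V))
      ((MvPolynomial.uniqueAlgEquiv k (Fin 1)).symm : k[X] ≃+* MvPolynomial (Fin 1) k) hg
  let := h.toRingHom.toAlgebra
  refine ⟨Γ(C.X, V), inferInstance, inferInstance, inferInstance, h.toRingHom.toAlgebra,
    .of_algebraMap_eq fun c => (algebraMap_sections V c).symm,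
    .of_algebraMap_eq' h.comp_algebraMap.symm, hh,
    functionField_isFractionRing_of_isAffineOpen C.X V hV⟩

theorem nonempty_closedPoint_and_obstruction_ne_top :
    Nonempty C.ClosedPoint ∧ C.placeSystem.obstruction 0 ≠ ⊤ := by
  obtain ⟨A, _, _, _, _, _, _, _, _⟩ := C.exists_etale_polynomial_isFractionRing
  let := Algebra.compHom C.FunctionField (algebraMap k[X] A)
  have : IsScalarTower k[X] A C.FunctionField := .of_algebraMap_eq' rfl
  have : IsScalarTower k k[X] C.FunctionField := .of_algebraMap_eq fun c => by
    rw [IsScalarTower.algebraMap_apply k[X] A C.FunctionField,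
      ← IsScalarTower.algebraMap_apply k k[X] A, ← IsScalarTower.algebraMap_apply]
  have : IsDomain A := (IsFractionRing.injective A C.FunctionField).isDomain _
  have : FaithfulSMul k[X] C.FunctionField := by
    rw [faithfulSMul_iff_algebraMap_injective, IsScalarTower.algebraMap_eq k[X] A]
    exact (IsFractionRing.injective A C.FunctionField).comp injective_algebraMap_of_flat
  obtain ⟨n, u, hu, hmax⟩ := exists_maximal_linearIndependent_of_etale (R := k[X]) (A := A)
    (K := C.FunctionField)
  exact ⟨C.placeSystem.nonempty, C.placeSystem.relLength_box_sup_constants_adele_ne_top hu hmax⟩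

/-- Finiteness is essential: `genus` is a `finrank`, which would be `0` for an infinite-dimensional
`H1`, whereas the obstruction would be `⊤`. -/
theorem obstruction_eq_genus : C.placeSystem.obstruction 0 = C.genus := by
  have h : C.placeSystem.obstruction 0 = Module.length k C.H1 := by
    rw [PlaceSystem.obstruction, ← repartition_eq, ← integralRepartition_eq]
    rfl
  have : Module.Finite k C.H1 := by
    have h2 := C.nonempty_closedPoint_and_obstruction_ne_top.2
    rw [PlaceSystem.obstruction, ← repartition_eq, ← integralRepartition_eq] at h2
    exact finite_of_relLength_ne_top h2
  rw [h, Module.length_eq_finrank, genus]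

theorem L_eq_space (G : C.Divisor) : C.L G = C.placeSystem.space G := by
  ext s
  rw [PlaceSystem.mem_space]
  exact C.mem_L_iff_aux G s

theorem finite_L_and_finrank {G : C.Divisor} (hG : 2 * (C.genus : ℤ) - 2 < G.degree) :
    Module.Finite k (C.L G) ∧ (Module.finrank k (C.L G) : ℤ) = G.degree + 1 - C.genus := by
  have := C.nonempty_closedPoint_and_obstruction_ne_top.1
  obtain ⟨l, hl, hl'⟩ := C.placeSystem.length_space_eq C.obstruction_eq_genus hG
  rw [← L_eq_space] at hl
  have hfin : Module.Finite k (C.L G) := by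
    have h : Module.length k (C.L G) ≠ ⊤ := hl ▸ ENat.natCast_ne_top l
    rw [Module.length_ne_top_iff, isFiniteLength_iff_isNoetherian_isArtinian] at h
    have := h.1
    infer_instance
  rw [Module.length_eq_finrank, Nat.cast_inj] at hl
  exact ⟨hfin, by rw [hl]; exact hl'⟩

theorem L_eq_bot {G : C.Divisor} (hG : G.degree < 0) : C.L G = ⊥ := by
  have := C.nonempty_closedPoint_and_obstruction_ne_top.1
  rw [L_eq_space]
  exact C.placeSystem.space_eq_bot C.obstruction_eq_genus hG

/-! ### Evaluation at rational points -/

variable {C}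

theorem RationalPoint.valuation_le_of_eval_eq_zero (x : C.RationalPoint) {s : x.1.regular}
    (hs : x.eval s = 0) : x.1.valuation s ≤ exp (-1) := by
  obtain ⟨_, a, rfl⟩ := s
  refine (x.1.residue_eq_zero_iff a).mp ?_
  have h : (AlgEquiv.ofInjective (IsScalarTower.toAlgHom k x.1.O C.FunctionField)
      (IsFractionRing.injective x.1.O C.FunctionField)).symm
      ⟨algebraMap x.1.O C.FunctionField a, a, rfl⟩ = a := by
    rw [AlgEquiv.symm_apply_eq]
    rfl
  have h2 : x.residueEquiv.symm (algebraMap x.1.O x.1.κ a) = 0 := by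
    rw [← hs]
    exact congrArg (fun b => x.residueEquiv.symm (algebraMap x.1.O x.1.κ b)) h.symm
  exact (map_eq_zero_iff _ x.residueEquiv.symm.injective).mp h2

theorem RationalPoint.finrank_residueField (x : C.RationalPoint) :
    Module.finrank k x.1.κ = 1 := by
  rw [← x.residueEquiv.toLinearEquiv.finrank_eq, Module.finrank_self]

variable (C)

theorem degree_pointDivisor {n : ℕ} (p : Fin n → C.RationalPoint) :
    C.placeSystem.degree (C.pointDivisor p) = n := by
  have h : ∀ s : Finset (Fin n), C.placeSystem.degree
      (∑ i ∈ s, Finsupp.single (p i).1 1 : C.Divisor) = s.card := by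
    classical
    intro s
    induction s using Finset.induction with
    | empty => exact C.placeSystem.degree_zero
    | insert i s hi ih =>
      rw [Finset.sum_insert hi, PlaceSystem.degree_add, ih, PlaceSystem.degree_single,
        Finset.card_insert_of_notMem hi]
      have : C.placeSystem.residueDegree (p i).1 = 1 := (p i).finrank_residueField
      rw [this]
      push_cast
      ring
  rw [pointDivisor, h, Finset.card_univ, Fintype.card_fin]

theorem pointDivisor_apply {n : ℕ} {p : Fin n → C.RationalPoint} (hp : Function.Injective p)
    (i : Fin n) : C.pointDivisor p (p i).1 = 1 := by
  classical
  rw [pointDivisor, Finsupp.finsetSum_apply, Finset.sum_eq_single i]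
  · simp
  · intro j _ hj
    rw [Finsupp.single_apply, if_neg]
    exact fun h => hj (hp (Subtype.ext h))
  · simp

theorem pointDivisor_apply_of_ne {n : ℕ} {p : Fin n → C.RationalPoint} {x : C.ClosedPoint}
    (hx : ∀ i, x ≠ (p i).1) : C.pointDivisor p x = 0 := by
  classical
  rw [pointDivisor, Finsupp.finsetSum_apply]
  refine Finset.sum_eq_zero fun i _ => ?_
  rw [Finsupp.single_apply, if_neg (hx i).symm]

/-- Functions in `L(G)` vanishing at the points of `D` lie in `L(G - D)`. -/
theorem mem_L_sub_of_evaluation_eq_zero {n : ℕ} {p : Fin n → C.RationalPoint}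
    (hp : Function.Injective p) {G : C.Divisor}
    (hG : Disjoint G.support (C.pointDivisor p).support) {s : C.L G}
    (hs : C.evaluation p G hG s = 0) : (s : C.FunctionField) ∈ C.L (G - C.pointDivisor p) := by
  refine (C.mem_L_iff_aux _ _).mpr fun x => ?_
  rw [Finsupp.sub_apply]
  by_cases hx : ∃ i, x = (p i).1
  · obtain ⟨i, rfl⟩ := hx
    have h0 : G (p i).1 = 0 := Finsupp.notMem_support_iff.mp fun h =>
      Finset.disjoint_left.mp hG h (C.mem_support_pointDivisor p i)
    -- At `p i` the bound of `G - D` is exactly `-1`: `G` is zero there by disjointness, and `D` has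
    -- coefficient 1 because the points are distinct.
    rw [h0, C.pointDivisor_apply hp]
    exact (p i).valuation_le_of_eval_eq_zero
      (s := Submodule.inclusion (C.L_le_regular p G hG i) s) (congrFun hs i)
  · rw [C.pointDivisor_apply_of_ne (not_exists.mp hx), sub_zero]
    exact (C.mem_L_iff_aux G s).mp s.2 x

theorem injective_evaluation {n : ℕ} {p : Fin n → C.RationalPoint} (hp : Function.Injective p)
    {G : C.Divisor} (hG : Disjoint G.support (C.pointDivisor p).support)
    (hupp : G.degree < (n : ℤ)) : Function.Injective (C.evaluation p G hG) := by
  rw [injective_iff_map_eq_zero]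
  intro s hs
  have h := C.mem_L_sub_of_evaluation_eq_zero hp hG hs
  rw [C.L_eq_bot, Submodule.mem_bot] at h
  · exact Subtype.ext h
  -- The degree of a divisor on the curve is definitionally its degree in the place system.
  · change C.placeSystem.degree _ < 0
    rw [PlaceSystem.degree_sub, degree_pointDivisor]
    exact sub_neg.mpr hupp

end SmoothProjectiveCurve

end ConvolutionalGoppa

end

theorem proposition2p3 {F : Type u} [Field F] [Finite F]
    (C : ConvolutionalGoppa.SmoothProjectiveCurve (RatFunc F)) {n : ℕ}
    (p : Fin n → C.RationalPoint) (hp : Function.Injective p) (G : C.Divisor)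
    (hG : Disjoint G.support (C.pointDivisor p).support)
    (hlow : 2 * (C.genus : ℤ) - 2 < G.degree) (hupp : G.degree < (n : ℤ)) :
    Function.Injective (C.evaluation p G hG) ∧
      (Module.finrank (RatFunc F) (C.goppaCode p G hG) : ℤ) = G.degree + 1 - (C.genus : ℤ) := by
  have hinj := C.injective_evaluation hp hG hupp
  refine ⟨hinj, ?_⟩
  rw [← (C.finite_L_and_finrank hlow).2, ConvolutionalGoppa.SmoothProjectiveCurve.goppaCode,
    LinearMap.finrank_range_of_inj hinj]
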